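/- Let $\phi=\frac{1+\sqrt5}{2}$ and let $\xi$ be a fixed real number with $-\frac{2+\sqrt5}{5}<\xi<\frac{2+\sqrt5}{27}$. Put $$F(x,y,z)=-(5-\sqrt5)yz^5-(5+\sqrt5)y^5z+20y^3z^3-(10+10\sqrt5)x^2yz^3-(10-10\sqrt5)x^2y^3z+10x^4yz .$$ Let $p,q,r$ be real functions on a non-empty open interval $J\subseteq\mathbb R$ that solve the icosahedral system $$p'=F(p,q,r),\quad q'=F(q,r,p),\quad r'=F(r,p,q),\quad p^2+q^2+r^2=1,\quad (\phi^2p^2-q^2)(\phi^2q^2-r^2)(\phi^2r^2-p^2)=\xi .$$ Let $P=\phi^2p^2-q^2$, $Q=\phi^2q^2-r^2$, $R=\phi^2r^2-p^2$, and let $\Upsilon=\frac{P^3-\phi P^2-\xi}{P}$, or the same expression with $Q$ or $R$ in place of $P$; if $\xi=0$, assume that the chosen function among $P,Q,R$ has no zero on $J$ (for $\xi\neq0$ this is automatic). Further, let $$\mathfrak l_\xi(X)=14\phi X-22\xi-4\phi^3,\qquad \mathfrak t_\xi(X)=20X^3+5\phi^2X^2-90\phi\xi X-135\xi^2-20\phi^3\xi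 .$$ Then $\Upsilon$ is differentiable on $J$ and the pair $(X,Y)=(\Upsilon,\Upsilon')$ satisfies $$\big(Y^2\phi^5+\mathfrak l_\xi(X)\,\mathfrak t_\xi(X)\big)^2=4\,\mathfrak t_\xi(X)^3$$ at every point of $J$. If $\xi\ne0$, or if $\xi=0$ and $(p,q,r)$ is not constant, then $(\Upsilon,\Upsilon')$ parametrizes this curve: a polynomial in $\mathbb C[X,Y]$ vanishes at all points $(\Upsilon(t),\Upsilon'(t))$, $t\in J$, if and only if it is divisible by $(Y^2\phi^5+\mathfrak l_\xi(X)\mathfrak t_\xi(X))^2-4\mathfrak t_\xi(X)^3$. For $\xi\neq0$ in the given range the curve is irreducible over $\mathbb C$ and has genus $3$; that is, its smooth projective model $C$ has arithmetic genus $1-\dim_{\mathbb C}H^0(C,\mathcal O_C)+\dim_{\mathbb C}H^1(C,\mathcal O_C)=3$. -/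

import Mathlib

open scoped Polynomial

noncomputable section

namespace Icosahedral

/-! ## The differential system -/

/-- The golden ratio `(1 + √5) / 2`. -/
abbrev phi : ℝ := Real.goldenRatio

/-- Right-hand side of the first equation of the icosahedral system; the other two arise from it
by cyclic permutation of the variables. -/
def rhs (x y z : ℝ) : ℝ :=
  -(5 - √5) * y * z ^ 5 - (5 + √5) * y ^ 5 * z + 20 * y ^ 3 * z ^ 3
    - (10 + 10 * √5) * x ^ 2 * y * z ^ 3 - (10 - 10 * √5) * x ^ 2 * y ^ 3 * z
    + 10 * x ^ 4 * y * z

/-- `(p, q, r)` solves the icosahedral differential system with parameter `ξ` on the set `J`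
of (real) times. -/
structure IsSolution (ξ : ℝ) (J : Set ℝ) (p q r : ℝ → ℝ) : Prop where
  deriv_p : ∀ t ∈ J, HasDerivAt p (rhs (p t) (q t) (r t)) t
  deriv_q : ∀ t ∈ J, HasDerivAt q (rhs (q t) (r t) (p t)) t
  deriv_r : ∀ t ∈ J, HasDerivAt r (rhs (r t) (p t) (q t)) t
  sphere : ∀ t ∈ J, p t ^ 2 + q t ^ 2 + r t ^ 2 = 1
  level : ∀ t ∈ J, (phi ^ 2 * p t ^ 2 - q t ^ 2) * (phi ^ 2 * q t ^ 2 - r t ^ 2)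
    * (phi ^ 2 * r t ^ 2 - p t ^ 2) = ξ

/-- The function `t ↦ φ² a(t)² - b(t)²`; thus `P = quad p q`, `Q = quad q r`, `R = quad r p`. -/
def quad (a b : ℝ → ℝ) (t : ℝ) : ℝ := phi ^ 2 * a t ^ 2 - b t ^ 2

/-- The function `Υ = (X³ - φ X² - ξ) / X` built from a function `X` (one of `P`, `Q`, `R`). -/
def upsilon (ξ : ℝ) (X : ℝ → ℝ) (t : ℝ) : ℝ := (X t ^ 3 - phi * X t ^ 2 - ξ) / X t

/-! ## The curve -/

/-- The linear polynomial `𝔩_ξ`. -/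
def lPoly (ξ : ℝ) : ℝ[X] :=
  Polynomial.C (14 * phi) * Polynomial.X - Polynomial.C (22 * ξ) - Polynomial.C (4 * phi ^ 3)

/-- The cubic polynomial `𝔱_ξ`. -/
def tPoly (ξ : ℝ) : ℝ[X] :=
  20 * Polynomial.X ^ 3 + Polynomial.C (5 * phi ^ 2) * Polynomial.X ^ 2
    - Polynomial.C (90 * phi * ξ) * Polynomial.X
    - Polynomial.C (135 * ξ ^ 2) - Polynomial.C (20 * phi ^ 3 * ξ)

/-- The two-variable polynomial `(Y² φ⁵ + 𝔩_ξ(X) 𝔱_ξ(X))² - 4 𝔱_ξ(X)³`, over the complex numbers.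
The inner variable is `X`, the outer one is `Y`. -/
def curvePoly (ξ : ℝ) : ℂ[X][X] :=
  (Polynomial.X ^ 2 * Polynomial.C (Polynomial.C ((phi : ℂ) ^ 5))
      + Polynomial.C ((lPoly ξ * tPoly ξ).map (algebraMap ℝ ℂ))) ^ 2
    - 4 * Polynomial.C ((tPoly ξ).map (algebraMap ℝ ℂ)) ^ 3

/-- The real functions `(X, Y)` on `J` parametrize the plane curve with reduced equation `f = 0`:
the curve is the Zariski closure of the set of points `(X(t), Y(t))`, i.e. the polynomials that
vanish identically along `(X, Y)` are exactly the multiples of `f`. -/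
def Parametrizes (f : ℂ[X][X]) (J : Set ℝ) (X Y : ℝ → ℝ) : Prop :=
  ∀ g : ℂ[X][X], (∀ t ∈ J, g.evalEval (X t : ℂ) (Y t : ℂ) = 0) ↔ f ∣ g

/-! ## The genus

For an irreducible plane curve `f(X, Y) = 0` (with `f` of positive degree in `Y`) with function
field `K`, the smooth projective model `C` of the curve is covered by two affine open sets, the
preimages of `ℙ¹ ∖ {∞}` and `ℙ¹ ∖ {0}` under the finite map `X : C → ℙ¹`. Their coordinate rings
are the integral closures in `K` of `ℂ[X]` and `ℂ[X⁻¹]`, and that of their intersection is the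
integral closure of `ℂ[X, X⁻¹]`. The cohomology of the structure sheaf of `C` is the cohomology of
the Čech complex of this cover. -/

/-- The integral closure in `K` of the subalgebra `ℂ[s]` generated by `s`. -/
def integralOver {K : Type*} [CommRing K] [Algebra ℂ K] (s : Set K) : Subalgebra ℂ K :=
  (integralClosure (Algebra.adjoin ℂ s) K).restrictScalars ℂ

theorem integralOver_mono {K : Type*} [CommRing K] [Algebra ℂ K] {s u : Set K} (h : s ⊆ u) :
    integralOver s ≤ integralOver u := by
  intro z hz
  have hz' : IsIntegral (Algebra.adjoin ℂ s) z := hz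
  obtain ⟨m, hm, hmz⟩ := hz'
  refine (show IsIntegral (Algebra.adjoin ℂ u) z from
    ⟨m.map (Subalgebra.inclusion (Algebra.adjoin_mono h)).toRingHom, hm.map _, ?_⟩)
  rw [Polynomial.eval₂_map]
  exact hmz

/-- The Čech differential `B₀ × B_∞ → B_{0∞}`, `(a, b) ↦ b - a`, of the structure sheaf for the
cover by `x ≠ ∞` and `x ≠ 0`. (`Ring.inverse x` is `x⁻¹`, for a unit `x`.) -/
def cechDiff {K : Type*} [CommRing K] [Algebra ℂ K] (x : K) :
    (integralOver {x} × integralOver {Ring.inverse x}) →ₗ[ℂ] integralOver {x, Ring.inverse x} :=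
  (Subalgebra.inclusion (integralOver_mono (by simp))).toLinearMap ∘ₗ LinearMap.snd ℂ _ _
    - (Subalgebra.inclusion (integralOver_mono (by simp))).toLinearMap ∘ₗ LinearMap.fst ℂ _ _

/-- The function field of the plane curve `f = 0`. -/
abbrev FunctionField (f : ℂ[X][X]) : Type := FractionRing (AdjoinRoot f)

/-- The coordinate function `X` in the function field. -/
def coordX (f : ℂ[X][X]) : FunctionField f :=
  algebraMap (AdjoinRoot f) (FunctionField f) (AdjoinRoot.of f Polynomial.X)

/-- `dim H⁰(C, 𝒪)`, for the smooth projective model `C` of the irreducible curve `f = 0`. -/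
def hZero (f : ℂ[X][X]) : ℕ := Module.finrank ℂ (LinearMap.ker (cechDiff (coordX f)))

/-- `dim H¹(C, 𝒪)`, for the smooth projective model `C` of the irreducible curve `f = 0`. -/
def hOne (f : ℂ[X][X]) : ℕ :=
  Module.finrank ℂ
    (integralOver {coordX f, Ring.inverse (coordX f)} ⧸ LinearMap.range (cechDiff (coordX f)))

/-- The arithmetic genus `1 - χ(𝒪) = 1 - dim H⁰(C, 𝒪) + dim H¹(C, 𝒪)` of the smooth projective
model `C` of the irreducible curve `f = 0`. -/
def arithmeticGenus (f : ℂ[X][X]) : ℤ := 1 - (hZero f : ℤ) + (hOne f : ℤ)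

end Icosahedral

end

/-! ### Golden-ratio arithmetic and the algebraic relation between Υ and its derivative -/

noncomputable section

namespace Icosahedral

/-! The curve equation. Since φ² - 1 = φ, the sphere gives P + Q + R = φ, and PQR = ξ; hence each of
P, Q, R is a root of one monic cubic, and Υ is the symmetric function -(PQ + QR + RP), whichever
root was chosen (`upsilon_eq`). With V the Vandermonde product of P, Q, R, three identities suffice:
Υ' = (16φ - 48) pqr V; the discriminant formula 𝔱(Υ) = 5V²; and (16φ - 48)² φ⁵ (pqr)² + 5 𝔩(Υ) =
-10√5 V. The last one times V² reads Υ'² φ⁵ + 𝔩𝔱 = -10√5 V³, and squaring gives 500 V⁶ = 4𝔱³.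

Parametrization. If Υ were constant, then P, Q, R would be constant by continuity, and so would p,
q, r. The solution would be an equilibrium, and `equilibrium` places these on the levels ξ = 0,
φ³/27, -φ³/5 only. The nonzero ones are the ends of the allowed interval, because φ³ = 2 + √5. So Υ
takes infinitely many values. A polynomial vanishing at infinitely many X-values of an irreducible
curve is a multiple of its equation (`dvd_of_evalEval_eq_zero`); irreducibility follows from odd
degrees in X of two coefficient expressions.

Genus. After scaling X and Y by φ² and putting ξ = φ³η, the function field contains s with s² = 𝔱,
and w = Y/s satisfies (w² + 𝔩)² = 4𝔱. This plane quartic is birational to the curve. It is smooth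
both in the chart (x, w) and in the chart (1/x, w/x), as 𝔱 and 𝔩² - 4𝔱 have simple roots off the
three exceptional levels. Smooth affine curves have integrally closed coordinate rings, so the rings
of the Čech complex are spanned by explicit monomials xⁿwⁱ with i < 4, and counting exponents gives
h⁰ = 1 and h¹ = 3. -/

theorem sqrt_five_eq : √5 = 2 * phi - 1 := by
  unfold phi Real.goldenRatio; ring

theorem rhs_eq (x y z : ℝ) : rhs x y z = y * z * ((2 * phi - 6) * z ^ 4 - (4 + 2 * phi) * y ^ 4
    + 20 * y ^ 2 * z ^ 2 - 20 * phi * x ^ 2 * z ^ 2 - (20 - 20 * phi) * x ^ 2 * y ^ 2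
    + 10 * x ^ 4) := by
  unfold rhs; rw [sqrt_five_eq]; ring

/-- Reducing every power of φ to a linear expression turns an identity over ℤ[φ] into one that
`ring` decides. -/
theorem phi_pow : phi ^ 2 = phi + 1 ∧ phi ^ 3 = 2 * phi + 1 ∧ phi ^ 4 = 3 * phi + 2 ∧
    phi ^ 5 = 5 * phi + 3 ∧ phi ^ 6 = 8 * phi + 5 ∧ phi ^ 7 = 13 * phi + 8 := by
  have h : phi ^ 2 = phi + 1 := Real.goldenRatio_sq
  refine ⟨h, ?_, ?_, ?_, ?_, ?_⟩
  · linear_combination (phi + 1) * h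
  · linear_combination (phi ^ 2 + phi + 2) * h
  · linear_combination (phi ^ 3 + phi ^ 2 + 2 * phi + 3) * h
  · linear_combination (phi ^ 4 + phi ^ 3 + 2 * phi ^ 2 + 3 * phi + 5) * h
  · linear_combination (phi ^ 5 + phi ^ 4 + 2 * phi ^ 3 + 3 * phi ^ 2 + 5 * phi + 8) * h

/-- The symmetric form `-(PQ + QR + RP)` of `Υ`. -/
def sym (p q r : ℝ → ℝ) (t : ℝ) : ℝ :=
  -(quad p q t * quad q r t + quad q r t * quad r p t + quad r p t * quad p q t)

/-- The Vandermonde product of `P, Q, R`. -/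
def vander (p q r : ℝ → ℝ) (t : ℝ) : ℝ :=
  (quad p q t - quad q r t) * (quad q r t - quad r p t) * (quad r p t - quad p q t)

theorem sym_rotate (p q r : ℝ → ℝ) (t : ℝ) : sym q r p t = sym p q r t := by
  unfold sym; ring

theorem quad_sum {a b c : ℝ} (h : a ^ 2 + b ^ 2 + c ^ 2 = 1) :
    (phi ^ 2 * a ^ 2 - b ^ 2) + (phi ^ 2 * b ^ 2 - c ^ 2) + (phi ^ 2 * c ^ 2 - a ^ 2) = phi := by
  linear_combination (a ^ 2 + b ^ 2 + c ^ 2) * phi_pow.1 + phi * h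

theorem sym_deriv_identity (p q r : ℝ) :
    -((phi ^ 2 * (2 * p * rhs p q r) - 2 * q * rhs q r p)
          * ((phi ^ 2 * q ^ 2 - r ^ 2) + (phi ^ 2 * r ^ 2 - p ^ 2))
        + (phi ^ 2 * (2 * q * rhs q r p) - 2 * r * rhs r p q)
          * ((phi ^ 2 * r ^ 2 - p ^ 2) + (phi ^ 2 * p ^ 2 - q ^ 2))
        + (phi ^ 2 * (2 * r * rhs r p q) - 2 * p * rhs p q r)
          * ((phi ^ 2 * p ^ 2 - q ^ 2) + (phi ^ 2 * q ^ 2 - r ^ 2)))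
      = (16 * phi - 48) * (p * q * r)
        * (((phi ^ 2 * p ^ 2 - q ^ 2) - (phi ^ 2 * q ^ 2 - r ^ 2))
          * ((phi ^ 2 * q ^ 2 - r ^ 2) - (phi ^ 2 * r ^ 2 - p ^ 2))
          * ((phi ^ 2 * r ^ 2 - p ^ 2) - (phi ^ 2 * p ^ 2 - q ^ 2))) := by
  obtain ⟨h2, h3, h4, h5, h6, h7⟩ := phi_pow
  simp only [rhs_eq]
  generalize phi = φ at *
  ring_nf
  simp only [h2, h3, h4, h5, h6, h7]
  ring

/-- Applied to the squares a = p², b = q², c = r², this expresses (pqr)² through Υ, ξ and V, which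
removes pqr from the formula for Υ'². -/
theorem abc_identity {a b c : ℝ} (h : a + b + c = 1) :
    (16 * phi - 48) ^ 2 * phi ^ 5 * (a * b * c)
      + 5 * (14 * phi * -((phi ^ 2 * a - b) * (phi ^ 2 * b - c)
          + (phi ^ 2 * b - c) * (phi ^ 2 * c - a) + (phi ^ 2 * c - a) * (phi ^ 2 * a - b))
        - 22 * ((phi ^ 2 * a - b) * (phi ^ 2 * b - c) * (phi ^ 2 * c - a)) - 4 * phi ^ 3)
      = -(10 * (2 * phi - 1)) * (((phi ^ 2 * a - b) - (phi ^ 2 * b - c))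
          * ((phi ^ 2 * b - c) - (phi ^ 2 * c - a)) * ((phi ^ 2 * c - a) - (phi ^ 2 * a - b))) := by
  obtain ⟨h2, h3, h4, h5, h6, h7⟩ := phi_pow
  obtain rfl : c = 1 - a - b := by linear_combination h
  generalize phi = φ at *
  ring_nf
  simp only [h2, h3, h4, h5, h6, h7]
  ring

/-- The discriminant of the cubic with roots P, Q, R, written in its coefficients: 𝔱 is five times
that discriminant. -/
theorem disc_identity {P Q R : ℝ} (h : P + Q + R = phi) :
    20 * (-(P * Q + Q * R + R * P)) ^ 3 + 5 * phi ^ 2 * (-(P * Q + Q * R + R * P)) ^ 2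
      - 90 * phi * (P * Q * R) * (-(P * Q + Q * R + R * P)) - 135 * (P * Q * R) ^ 2
      - 20 * phi ^ 3 * (P * Q * R)
      = 5 * ((P - Q) * (Q - R) * (R - P)) ^ 2 := by
  rw [← h]; ring

theorem lPoly_eval (ξ x : ℝ) : (lPoly ξ).eval x = 14 * phi * x - 22 * ξ - 4 * phi ^ 3 := by
  simp [lPoly]

theorem tPoly_eval (ξ x : ℝ) : (tPoly ξ).eval x = 20 * x ^ 3 + 5 * phi ^ 2 * x ^ 2
    - 90 * phi * ξ * x - 135 * ξ ^ 2 - 20 * phi ^ 3 * ξ := by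
  simp [tPoly]

namespace IsSolution

variable {ξ : ℝ} {J : Set ℝ} {p q r : ℝ → ℝ}

theorem rotate (h : IsSolution ξ J p q r) : IsSolution ξ J q r p where
  deriv_p := h.deriv_q
  deriv_q := h.deriv_r
  deriv_r := h.deriv_p
  sphere t ht := by linear_combination h.sphere t ht
  level t ht := by linear_combination h.level t ht

theorem quad_add (h : IsSolution ξ J p q r) {t : ℝ} (ht : t ∈ J) :
    quad p q t + quad q r t + quad r p t = phi := quad_sum (h.sphere t ht)

theorem quad_mul (h : IsSolution ξ J p q r) {t : ℝ} (ht : t ∈ J) :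
    quad p q t * quad q r t * quad r p t = ξ := h.level t ht

/-- Vieta: P is a root of X³ - φX² - ΥX - ξ with Υ the symmetric form, and this equation is solved
for Υ. -/
theorem upsilon_eq (h : IsSolution ξ J p q r) {t : ℝ} (ht : t ∈ J) (h0 : quad p q t ≠ 0) :
    upsilon ξ (quad p q) t = sym p q r t := by
  unfold upsilon sym
  rw [div_eq_iff h0]
  linear_combination (quad p q t ^ 2) * h.quad_add ht + h.quad_mul ht

theorem hasDerivAt_quad (h : IsSolution ξ J p q r) {t : ℝ} (ht : t ∈ J) :
    HasDerivAt (quad p q) (phi ^ 2 * (2 * p t * rhs (p t) (q t) (r t))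
      - 2 * q t * rhs (q t) (r t) (p t)) t := by
  have h1 := (((h.deriv_p t ht).pow 2).const_mul (phi ^ 2)).sub ((h.deriv_q t ht).pow 2)
  exact HasDerivAt.congr_deriv (f := quad p q) h1 (by push_cast; ring)

theorem hasDerivAt_sym (h : IsSolution ξ J p q r) {t : ℝ} (ht : t ∈ J) :
    HasDerivAt (sym p q r) ((16 * phi - 48) * (p t * q t * r t) * vander p q r t) t := by
  have hP := h.hasDerivAt_quad ht
  have hQ := h.rotate.hasDerivAt_quad ht
  have hR := h.rotate.rotate.hasDerivAt_quad ht
  have h1 := (((hP.mul hQ).add (hQ.mul hR)).add (hR.mul hP)).neg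
  refine HasDerivAt.congr_deriv (f := sym p q r) h1 ?_
  unfold vander
  simp only [quad]
  rw [← sym_deriv_identity]
  ring

theorem curve_relation (h : IsSolution ξ J p q r) {t : ℝ} (ht : t ∈ J) :
    (((16 * phi - 48) * (p t * q t * r t) * vander p q r t) ^ 2 * phi ^ 5
      + (lPoly ξ).eval (sym p q r t) * (tPoly ξ).eval (sym p q r t)) ^ 2
      = 4 * (tPoly ξ).eval (sym p q r t) ^ 3 := by
  have h1 := abc_identity (h.sphere t ht)
  have h2 := disc_identity (h.quad_add ht)
  rw [h.quad_mul ht] at h2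
  rw [h.level t ht] at h1
  have ht' : (tPoly ξ).eval (sym p q r t) = 5 * vander p q r t ^ 2 := by
    rw [tPoly_eval]; unfold sym vander; linear_combination h2
  have hl : (16 * phi - 48) ^ 2 * phi ^ 5 * (p t ^ 2 * q t ^ 2 * r t ^ 2)
      + 5 * (lPoly ξ).eval (sym p q r t) = -(10 * (2 * phi - 1)) * vander p q r t := by
    rw [lPoly_eval]; unfold sym vander quad; linear_combination h1
  rw [ht']
  -- Since 2φ - 1 = √5, both sides of the goal become 500 V⁶.
  have h5 : (2 * phi - 1) ^ 2 = 5 := by linear_combination 4 * phi_pow.1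
  have h6 : ((16 * phi - 48) * (p t * q t * r t) * vander p q r t) ^ 2 * phi ^ 5
      + (lPoly ξ).eval (sym p q r t) * (5 * vander p q r t ^ 2)
      = -(10 * (2 * phi - 1)) * vander p q r t ^ 3 := by
    linear_combination vander p q r t ^ 2 * hl
  rw [h6]
  linear_combination 100 * vander p q r t ^ 6 * h5

end IsSolution

/-! ### Equilibria and non-constancy of Υ -/

theorem phi_bounds : 1 < phi ∧ phi < 2 := ⟨Real.one_lt_goldenRatio, Real.goldenRatio_lt_two⟩

/-- An equilibrium on the coordinate circle `p = 0`, off the zero level, is at an extremal level. -/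
theorem equilibrium_circle {q r ξ : ℝ} (hs : q ^ 2 + r ^ 2 = 1)
    (h : rhs 0 q r = 0) (hξ : (phi ^ 2 * 0 ^ 2 - q ^ 2) * (phi ^ 2 * q ^ 2 - r ^ 2)
      * (phi ^ 2 * r ^ 2 - 0 ^ 2) = ξ) : ξ = 0 ∨ 27 * ξ = phi ^ 3 ∨ 5 * ξ = -phi ^ 3 := by
  obtain ⟨h2, h3, h4, h5, h6, h7⟩ := phi_pow
  rw [rhs_eq] at h
  have hr : r ^ 2 = 1 - q ^ 2 := by linear_combination hs
  have hpos := phi_bounds.1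
  have hfac : (q * r) * ((q ^ 2 - phi ^ 2 * r ^ 2) * (phi ^ 4 * q ^ 2 - r ^ 2)) = 0 := by
    have h4 : (4 + 2 * phi) ≠ 0 := by positivity
    generalize phi = φ at *
    have : (4 + 2 * φ) * ((q * r) * ((q ^ 2 - φ ^ 2 * r ^ 2) * (φ ^ 4 * q ^ 2 - r ^ 2)))
        = -φ ^ 4 * (q * r * ((2 * φ - 6) * r ^ 4 - (4 + 2 * φ) * q ^ 4
          + 20 * q ^ 2 * r ^ 2 - 20 * φ * 0 ^ 2 * r ^ 2 - (20 - 20 * φ) * 0 ^ 2 * q ^ 2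
          + 10 * 0 ^ 4)) := by
      ring_nf
      simp only [*]
      ring
    rw [h, mul_zero] at this
    exact (mul_eq_zero.1 this).resolve_left h4
  rcases mul_eq_zero.1 hfac with h0 | h0
  · left
    rw [← hξ]
    linear_combination (-phi ^ 2 * q * r * (phi ^ 2 * q ^ 2 - r ^ 2)) * h0
  rcases mul_eq_zero.1 h0 with h0 | h0
  · right; right
    have e : q ^ 2 = (2 + phi) / 5 := by
      rw [hr] at h0
      linear_combination (3 - phi) / 5 * h0 - (2 - phi) / 5 * (q ^ 2 - 1) * h2
    rw [← hξ, hr, e]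
    generalize phi = φ at *
    ring_nf
    simp only [h2, h3, h4, h5, h6, h7]
    ring
  · right; left
    have e : q ^ 2 = (2 - phi) / 3 := by
      rw [hr] at h0
      linear_combination (2 - phi) / 3 * h0 - (2 - phi) / 3 * q ^ 2 * h4 + q ^ 2 * h2
    rw [← hξ, hr, e]
    generalize phi = φ at *
    ring_nf
    simp only [h2, h3, h4, h5, h6, h7]
    ring

/-- On a coordinate circle the planar case applies. Elsewhere, with ξ ≠ 0, the equations reduce to
linear ones in the squares, which force p² = q² = r² = 1/3 and hence ξ = (φ² - 1)³/27 = φ³/27. -/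
theorem equilibrium {p q r ξ : ℝ} (hs : p ^ 2 + q ^ 2 + r ^ 2 = 1)
    (h1 : rhs p q r = 0) (h2 : rhs q r p = 0) (h3 : rhs r p q = 0)
    (hξ : (phi ^ 2 * p ^ 2 - q ^ 2) * (phi ^ 2 * q ^ 2 - r ^ 2)
      * (phi ^ 2 * r ^ 2 - p ^ 2) = ξ) : ξ = 0 ∨ 27 * ξ = phi ^ 3 ∨ 5 * ξ = -phi ^ 3 := by
  by_cases hp : p = 0
  · subst hp
    exact equilibrium_circle (by linear_combination hs) h1 hξ
  by_cases hq : q = 0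
  · subst hq
    exact equilibrium_circle (q := r) (r := p) (by linear_combination hs) h2
      (by linear_combination hξ)
  by_cases hr : r = 0
  · subst hr
    exact equilibrium_circle (q := p) (r := q) (by linear_combination hs) h3
      (by linear_combination hξ)
  by_cases h0 : ξ = 0
  · exact Or.inl h0
  right; left
  obtain ⟨k2, k3, -⟩ := phi_pow
  have key : ∀ x y z : ℝ, rhs x y z = 0 → rhs y z x = 0 → x ≠ 0 → y ≠ 0 → z ≠ 0 →
      phi ^ 2 * x ^ 2 - y ^ 2 ≠ 0 → (phi - 2) * x ^ 2 - y ^ 2 + (3 - phi) * z ^ 2 = 0 := by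
    intro x y z g1 g2 hx hy hz hP
    rw [rhs_eq] at g1 g2
    have g1' := (mul_eq_zero.1 g1).resolve_left (mul_ne_zero hy hz)
    have g2' := (mul_eq_zero.1 g2).resolve_left (mul_ne_zero hz hx)
    have : (phi ^ 2 * x ^ 2 - y ^ 2) * ((phi - 2) * x ^ 2 - y ^ 2 + (3 - phi) * z ^ 2) = 0 := by
      generalize phi = φ at *
      -- The multipliers cancel the z⁴ terms of the two quartic factors; the combination then splits
      -- off φ²x² - y².
      have e : 80 * ((φ ^ 2 * x ^ 2 - y ^ 2) * ((φ - 2) * x ^ 2 - y ^ 2 + (3 - φ) * z ^ 2))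
        = (-4 - 2 * φ) * ((2 * φ - 6) * z ^ 4 - (4 + 2 * φ) * y ^ 4
          + 20 * y ^ 2 * z ^ 2 - 20 * φ * x ^ 2 * z ^ 2 - (20 - 20 * φ) * x ^ 2 * y ^ 2
          + 10 * x ^ 4) + (6 - 2 * φ) * ((2 * φ - 6) * x ^ 4 - (4 + 2 * φ) * z ^ 4
          + 20 * z ^ 2 * x ^ 2 - 20 * φ * y ^ 2 * x ^ 2 - (20 - 20 * φ) * y ^ 2 * z ^ 2
          + 10 * y ^ 4) := by
        ring_nf
        simp only [k2, k3]
        ring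
      rw [g1', g2'] at e
      linear_combination e / 80
    exact (mul_eq_zero.1 this).resolve_left hP
  have hne : (phi ^ 2 * p ^ 2 - q ^ 2) * (phi ^ 2 * q ^ 2 - r ^ 2)
      * (phi ^ 2 * r ^ 2 - p ^ 2) ≠ 0 := by rwa [hξ]
  have m1 := key p q r h1 h2 hp hq hr (left_ne_zero_of_mul (left_ne_zero_of_mul hne))
  have m2 := key q r p h2 h3 hq hr hp (right_ne_zero_of_mul (left_ne_zero_of_mul hne))
  have hr2 : r ^ 2 = 1 - p ^ 2 - q ^ 2 := by linear_combination hs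
  rw [hr2] at m1 m2
  have e1 : p ^ 2 = 1 / 3 := by
    linear_combination phi / 12 * m1 + (1 / 4 + phi / 6) * m2
      + (1 / 12 - q ^ 2 / 4) * k2
  have e2 : q ^ 2 = 1 / 3 := by
    linear_combination (-1 / 4 - phi / 6) * m1 + (-1 / 4 - phi / 12) * m2
      + (p ^ 2 / 4 + q ^ 2 / 4 - 1 / 6) * k2
  have e3 : r ^ 2 = 1 / 3 := by linear_combination hs - e1 - e2
  rw [← hξ, e1, e2, e3]
  linear_combination ((phi ^ 2 - 1) ^ 2 + (phi ^ 2 - 1) * phi + phi ^ 2) * k2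

theorem constant_of_finite_range {J : Set ℝ} (hJ : IsPreconnected J) {f : ℝ → ℝ}
    (hf : ContinuousOn f J) (F : Set ℝ) (hF : F.Finite) (h : ∀ t ∈ J, f t ∈ F) :
    ∀ t ∈ J, ∀ s ∈ J, f t = f s := by
  intro t ht s hs
  exact hJ.constant_of_mapsTo hF.isDiscrete hf h ht hs

namespace IsSolution

variable {ξ : ℝ} {J : Set ℝ} {p q r : ℝ → ℝ}

/-- If `-(PQ + QR + RP)` is constant, then so is the solution. -/
theorem constant_of_sym_constant (h : IsSolution ξ J p q r) (hJ : IsPreconnected J)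
    (hc : ∀ t ∈ J, ∀ s ∈ J, sym p q r t = sym p q r s) : ∀ t ∈ J, ∀ s ∈ J, p t = p s := by
  have quadConst : ∀ {p q r : ℝ → ℝ}, IsSolution ξ J p q r →
      (∀ t ∈ J, ∀ s ∈ J, sym p q r t = sym p q r s) →
      ∀ t ∈ J, ∀ s ∈ J, quad p q t = quad p q s := by
    intro p q r h hc t₀ ht₀
    -- The cubic with roots P, Q, R has constant coefficients here, so P is a continuous function
    -- with values in a finite set.
    let f : ℝ[X] := Polynomial.X ^ 3 - Polynomial.C phi * Polynomial.X ^ 2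
      - Polynomial.C (sym p q r t₀) * Polynomial.X - Polynomial.C ξ
    have hf : f ≠ 0 := by
      intro h0
      have := congrArg (fun g : ℝ[X] => g.coeff 3) h0
      simp [f] at this
    refine constant_of_finite_range hJ (fun t ht => (h.hasDerivAt_quad ht).continuousAt.continuousWithinAt)
      {x | x ∈ f.roots} (Multiset.finite_toSet _) (fun t ht => ?_) t₀ ht₀
    rw [Set.mem_ofPred_eq, Polynomial.mem_roots hf, Polynomial.IsRoot.def]
    simp only [f, Polynomial.eval_sub, Polynomial.eval_pow, Polynomial.eval_X,
      Polynomial.eval_mul, Polynomial.eval_C]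
    rw [← hc t ht t₀ ht₀]
    unfold sym
    linear_combination (quad p q t ^ 2) * h.quad_add ht + h.quad_mul ht
  intro t₀ ht₀
  have k1 := quadConst h hc
  have k2 := quadConst h.rotate (by simpa only [sym_rotate] using hc)
  have k3 := quadConst h.rotate.rotate (by simpa only [sym_rotate] using hc)
  refine constant_of_finite_range hJ (fun t ht => (h.deriv_p t ht).continuousAt.continuousWithinAt)
    {p t₀, -p t₀} (Set.toFinite _) (fun t ht => ?_) t₀ ht₀
  have e1 := k1 t ht t₀ ht₀
  have e2 := k2 t ht t₀ ht₀
  have e3 := k3 t ht t₀ ht₀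
  unfold quad at e1 e2 e3
  -- In φ⁴P + φ²Q + R the squares of q and r cancel; this recovers p², hence p up to sign.
  have e : (phi ^ 6 - 1) * (p t ^ 2 - p t₀ ^ 2) = 0 := by
    linear_combination phi ^ 4 * e1 + phi ^ 2 * e2 + e3
  have h6 : phi ^ 6 - 1 ≠ 0 := by
    have := phi_pow.2.2.2.2.1
    have := phi_bounds.1
    nlinarith
  have := (mul_eq_zero.1 e).resolve_left h6
  exact sq_eq_sq_iff_eq_or_eq_neg.1 (by linear_combination this)

theorem deriv_eq_zero (h : IsSolution ξ J p q r) (hJ : IsOpen J)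
    (hc : ∀ t ∈ J, ∀ s ∈ J, p t = p s) {t : ℝ} (ht : t ∈ J) :
    rhs (p t) (q t) (r t) = 0 := by
  have h1 : p =ᶠ[nhds t] fun _ => p t :=
    Filter.eventually_of_mem (hJ.mem_nhds ht) fun s hs => hc s hs t ht
  exact (h.deriv_p t ht).unique ((hasDerivAt_const t (p t)).congr_of_eventuallyEq h1)

theorem sym_image_infinite (h : IsSolution ξ J p q r) (hJ : IsOpen J) (hJc : J.OrdConnected)
    (hne : J.Nonempty) (h1 : -phi ^ 3 < 5 * ξ) (h2 : 27 * ξ < phi ^ 3)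
    (h0 : ξ = 0 → ¬ ∀ t ∈ J, ∀ s ∈ J, p t = p s ∧ q t = q s ∧ r t = r s) :
    (sym p q r '' J).Infinite := by
  have hpre : IsPreconnected J := hJc.isPreconnected
  apply IsPreconnected.infinite_of_nontrivial
  · exact hpre.image _ fun t ht => (h.hasDerivAt_sym ht).continuousAt.continuousWithinAt
  by_contra hsub
  rw [Set.not_nontrivial_iff] at hsub
  have hc : ∀ t ∈ J, ∀ s ∈ J, sym p q r t = sym p q r s := fun t ht s hs =>
    hsub (Set.mem_image_of_mem _ ht) (Set.mem_image_of_mem _ hs)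
  have kp := h.constant_of_sym_constant hpre hc
  have kq := h.rotate.constant_of_sym_constant hpre (by simpa only [sym_rotate] using hc)
  have kr := h.rotate.rotate.constant_of_sym_constant hpre (by simpa only [sym_rotate] using hc)
  obtain ⟨t, ht⟩ := hne
  rcases equilibrium (h.sphere t ht) (h.deriv_eq_zero hJ kp ht) (h.rotate.deriv_eq_zero hJ kq ht)
    (h.rotate.rotate.deriv_eq_zero hJ kr ht) (h.level t ht) with h3 | h3 | h3
  · exact h0 h3 fun t ht s hs => ⟨kp t ht s hs, kq t ht s hs, kr t ht s hs⟩
  · linarith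
  · linarith

end IsSolution

/-! ### Irreducibility of the plane curve -/

section

open Polynomial

/-- The monic biquadratic polynomial `Y⁴ + b Y² + c`. -/
def biquadratic {R : Type*} [CommRing R] (b c : R) : R[X] := X ^ 4 + C b * X ^ 2 + C c

section Biquadratic
variable {R : Type*} [CommRing R] (b c : R)

theorem biquadratic_natDegree [Nontrivial R] : (biquadratic b c).natDegree = 4 := by
  unfold biquadratic; compute_degree!

theorem biquadratic_monic : (biquadratic b c).Monic := by
  unfold biquadratic; monicity!

/-- A linear factor gives a root y, and then b² - 4c = (2y² + b)². In a product of two monic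
quadratics the Y-coefficients are opposite: if they vanish, b² - 4c is a square; otherwise the
constant terms agree and c is a square. -/
theorem irreducible_biquadratic [IsDomain R] (hd : ¬ IsSquare (b ^ 2 - 4 * c))
    (hc : ¬ IsSquare c) : Irreducible (biquadratic b c) := by
  have hm := biquadratic_monic b c
  have hdeg := biquadratic_natDegree b c
  rw [hm.irreducible_iff_natDegree']
  refine ⟨fun h => by simp [h] at hdeg, fun f g hf hg hfg hmem => ?_⟩
  rw [hdeg, Finset.mem_Ioc] at hmem
  have hfd : f.natDegree = 4 - g.natDegree := by
    have := hf.natDegree_mul hg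
    rw [hfg, hdeg] at this
    omega
  obtain h1 | h1 : g.natDegree = 1 ∨ g.natDegree = 2 := by omega
  · have hr : (biquadratic b c).eval (-g.coeff 0) = 0 := by
      have : g = X + C (g.coeff 0) := hg.eq_X_add_C h1
      rw [← hfg, eval_mul, this]
      simp
    apply hd
    refine ⟨2 * (g.coeff 0) ^ 2 + b, ?_⟩
    simp only [biquadratic, eval_add, eval_pow, eval_X, eval_mul, eval_C] at hr
    linear_combination (-4) * hr
  · have hf2 : f.natDegree = 2 := by omega
    have hfe : f = X ^ 2 + C (f.coeff 1) * X + C (f.coeff 0) := by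
      conv_lhs => rw [f.as_sum_range_C_mul_X_pow, hf2]
      have : f.coeff 2 = 1 := by rw [← hf2]; exact hf
      simp [Finset.sum_range_succ, this]; ring
    have hge : g = X ^ 2 + C (g.coeff 1) * X + C (g.coeff 0) := by
      conv_lhs => rw [g.as_sum_range_C_mul_X_pow, h1]
      have : g.coeff 2 = 1 := by rw [← h1]; exact hg
      simp [Finset.sum_range_succ, this]; ring
    generalize f.coeff 1 = a₁ at *
    generalize f.coeff 0 = a₀ at *
    generalize g.coeff 1 = e₁ at *
    generalize g.coeff 0 = e₀ at *
    have hexp : f * g = X ^ 4 + C (a₁ + e₁) * X ^ 3 + C (a₀ + e₀ + a₁ * e₁) * X ^ 2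
        + C (a₁ * e₀ + a₀ * e₁) * X + C (a₀ * e₀) := by
      rw [hfe, hge]; simp only [C_add, C_mul]; ring
    have hcoeff : ∀ A₃ A₂ A₁ A₀ : R, X ^ 4 + C A₃ * X ^ 3 + C A₂ * X ^ 2 + C A₁ * X + C A₀
        = biquadratic b c → A₃ = 0 ∧ A₂ = b ∧ A₁ = 0 ∧ A₀ = c := by
      intro A₃ A₂ A₁ A₀ h
      have k (n) := congrArg (fun f : R[X] => f.coeff n) h
      refine ⟨by simpa [biquadratic, coeff_X, coeff_C] using k 3,
        by simpa [biquadratic, coeff_X, coeff_C] using k 2,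
        by simpa [biquadratic, coeff_X, coeff_C] using k 1,
        by simpa [biquadratic, coeff_X, coeff_C] using k 0⟩
    obtain ⟨k3, k2, k1, k0⟩ := hcoeff _ _ _ _ (hexp.symm.trans hfg)
    have : a₁ * (e₀ - a₀) = 0 := by linear_combination k1 - a₀ * k3
    rcases mul_eq_zero.1 this with h0 | h0
    · apply hd
      refine ⟨a₀ - e₀, ?_⟩
      rw [h0, zero_add] at k3
      rw [h0, k3] at k2
      rw [← k0, ← k2]; ring
    · apply hc
      exact ⟨a₀, by rw [← k0]; linear_combination a₀ * h0⟩

end Biquadratic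

theorem not_isSquare_of_odd_natDegree {R : Type*} [CommRing R] [IsDomain R] {p : R[X]}
    (h : Odd p.natDegree) : ¬ IsSquare p := by
  rintro ⟨q, rfl⟩
  by_cases hq : q = 0
  · simp [hq] at h
  · rw [natDegree_mul hq hq] at h
    exact (Nat.not_odd_iff_even.2 ⟨_, rfl⟩) h

theorem phi_ne_zero : (phi : ℂ) ≠ 0 := by
  exact_mod_cast Real.goldenRatio_ne_zero

theorem natDegree_tPoly_map (ξ : ℝ) : ((tPoly ξ).map (algebraMap ℝ ℂ)).natDegree = 3 := by
  rw [natDegree_map]; unfold tPoly; compute_degree!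

theorem natDegree_lPoly_map (ξ : ℝ) : ((lPoly ξ).map (algebraMap ℝ ℂ)).natDegree ≤ 1 := by
  rw [natDegree_map]; unfold lPoly; compute_degree

/-- `curvePoly` made monic. -/
theorem curvePoly_eq (ξ : ℝ) : curvePoly ξ = C (C ((phi : ℂ) ^ 10)) * biquadratic
    (C (2 * ((phi : ℂ) ^ 5)⁻¹) * (((lPoly ξ).map (algebraMap ℝ ℂ)) * ((tPoly ξ).map (algebraMap ℝ ℂ))))
    (C (((phi : ℂ) ^ 10)⁻¹) * (((lPoly ξ).map (algebraMap ℝ ℂ)) ^ 2 * ((tPoly ξ).map (algebraMap ℝ ℂ)) ^ 2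
      - 4 * ((tPoly ξ).map (algebraMap ℝ ℂ)) ^ 3)) := by
  have hφ := phi_ne_zero
  unfold curvePoly
  generalize (phi : ℂ) = φ at *
  have h1 : (C (C (φ ^ 10)) : ℂ[X][X]) * C (C ((φ ^ 10)⁻¹)) = 1 := by
    rw [← C_mul, ← C_mul, mul_inv_cancel₀ (pow_ne_zero _ hφ), C_1, C_1]
  have h2 : (C (C (φ ^ 10)) : ℂ[X][X]) * C (C (2 * (φ ^ 5)⁻¹))
      = 2 * C (C (φ ^ 5)) := by
    rw [← C_mul, ← C_mul]
    have : φ ^ 10 * (2 * (φ ^ 5)⁻¹) = 2 * φ ^ 5 := by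
      field_simp
    rw [this, C_mul, C_mul, C_ofNat, C_ofNat]
  have h3 : (C (C (φ ^ 10)) : ℂ[X][X]) = C (C (φ ^ 5)) ^ 2 := by
    rw [← C_pow, ← C_pow, ← pow_mul]
  unfold biquadratic
  simp only [Polynomial.map_mul, C_mul, C_sub, C_pow, C_ofNat] at *
  generalize C ((map (algebraMap ℝ ℂ)) (lPoly ξ)) = l at *
  generalize C ((map (algebraMap ℝ ℂ)) (tPoly ξ)) = t at *
  linear_combination (-(X ^ 4)) * h3 - X ^ 2 * l * t * h2 - (l ^ 2 * t ^ 2 - 4 * t ^ 3) * h1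

/-- Up to constants, b² - 4c is 𝔱³ and c is 𝔩²𝔱² - 4𝔱³. Both have degree 9 in X, so neither is a
square, for any ξ. -/
theorem irreducible_curvePoly (ξ : ℝ) : Irreducible (curvePoly ξ) := by
  have hφ := phi_ne_zero
  rw [curvePoly_eq]
  have hu : IsUnit (C (C ((phi : ℂ) ^ 10)) : ℂ[X][X]) :=
    ((isUnit_iff_ne_zero.2 (pow_ne_zero _ hφ)).map C).map C
  rw [irreducible_isUnit_mul hu]
  have ht := natDegree_tPoly_map ξ
  have hl := natDegree_lPoly_map ξ
  generalize (phi : ℂ) = φ at *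
  set t := (tPoly ξ).map (algebraMap ℝ ℂ)
  set l := (lPoly ξ).map (algebraMap ℝ ℂ)
  have ht0 : t ≠ 0 := by intro h; simp [h] at ht
  have d1 : (l ^ 2 * t ^ 2 - 4 * t ^ 3).natDegree = 9 := by
    have : (4 * t ^ 3).natDegree = 9 := by
      have : (4 : ℂ[X]) = C 4 := (C_ofNat 4).symm
      rw [this, natDegree_C_mul (by norm_num), natDegree_pow, ht]
    rw [natDegree_sub_eq_right_of_natDegree_lt, this]
    rw [this]
    refine natDegree_mul_le.trans_lt ?_
    rw [natDegree_pow, natDegree_pow, ht]; omega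
  apply irreducible_biquadratic
  · apply not_isSquare_of_odd_natDegree
    have : (C (2 * (φ ^ 5)⁻¹) * (l * t)) ^ 2
        - 4 * (C ((φ ^ 10)⁻¹) * (l ^ 2 * t ^ 2 - 4 * t ^ 3))
        = C (16 * (φ ^ 10)⁻¹) * t ^ 3 := by
      have e : (C (2 * (φ ^ 5)⁻¹)) ^ 2 = 4 * C ((φ ^ 10)⁻¹) := by
        rw [← C_ofNat 4, ← C_pow, ← C_mul]; congr 1; field_simp; norm_num
      rw [mul_pow, e, C_mul (a := (16 : ℂ)), C_ofNat]; ring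
    rw [this, natDegree_C_mul (by simp [hφ]), natDegree_pow, ht]
    decide
  · apply not_isSquare_of_odd_natDegree
    rw [natDegree_C_mul (by simp [hφ]), d1]
    decide

end

/-! ### Polynomials vanishing along the solution -/

section

open Polynomial

/-- If f does not divide g, the class of g is nonzero and integral over ℂ[X], so the ideal it
generates contains a nonzero d(X). Such a d vanishes at the first coordinate of every common zero of
f and g, which leaves only finitely many. -/
theorem dvd_of_evalEval_eq_zero {f g : ℂ[X][X]} (hm : f.Monic) (hf : Irreducible f)
    {S : Set (ℂ × ℂ)} (hfS : ∀ z ∈ S, f.evalEval z.1 z.2 = 0) (hS : (Prod.fst '' S).Infinite)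
    (hgS : ∀ z ∈ S, g.evalEval z.1 z.2 = 0) : f ∣ g := by
  have hp : Prime f := hf.prime
  have : IsDomain (AdjoinRoot f) := AdjoinRoot.isDomain_of_prime hp
  have : Module.Finite ℂ[X] (AdjoinRoot f) := hm.finite_adjoinRoot
  by_contra hfg
  have hg0 : AdjoinRoot.mk f g ≠ 0 := fun h => hfg (AdjoinRoot.mk_eq_zero.1 h)
  have hne := Ideal.comap_ne_bot_of_integral_mem (R := ℂ[X]) hg0
    (Ideal.mem_span_singleton_self (AdjoinRoot.mk f g)) (Algebra.IsIntegral.isIntegral _)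
  obtain ⟨d, hd, hd0⟩ := Submodule.exists_mem_ne_zero_of_ne_bot hne
  rw [Ideal.mem_comap, Ideal.mem_span_singleton] at hd
  obtain ⟨h, hh⟩ := hd
  obtain ⟨h, rfl⟩ := AdjoinRoot.mk_surjective h
  have hdvd : f ∣ C d - g * h := by
    rw [← AdjoinRoot.mk_eq_zero, map_sub, map_mul, ← hh]
    simp [AdjoinRoot.algebraMap_eq]
  obtain ⟨k, hk⟩ := hdvd
  apply hS
  refine (d.roots.toFinset.finite_toSet).subset ?_
  rintro _ ⟨z, hz, rfl⟩
  have := congrArg (evalEval z.1 z.2) hk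
  rw [evalEval_mul, hfS z hz, evalEval_sub, evalEval_mul, hgS z hz, evalEval_C] at this
  simpa [hd0] using this

theorem parametrizes_curvePoly {ξ : ℝ} {J : Set ℝ} {x y : ℝ → ℝ} (hinf : (x '' J).Infinite)
    (hxy : ∀ t ∈ J, (y t ^ 2 * phi ^ 5 + (lPoly ξ).eval (x t) * (tPoly ξ).eval (x t)) ^ 2
      = 4 * (tPoly ξ).eval (x t) ^ 3) : Parametrizes (curvePoly ξ) J x y := by
  have h0 : ∀ t ∈ J, (curvePoly ξ).evalEval (x t : ℂ) (y t : ℂ) = 0 := by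
    intro t ht
    have e (f : ℝ[X]) : (f.map (algebraMap ℝ ℂ)).eval (x t : ℂ) = (f.eval (x t) : ℝ) :=
      eval_map_algebraMap (B := ℂ) f _ |>.trans (aeval_algebraMap_apply ℂ (x t) f)
    simp only [curvePoly, evalEval_sub, evalEval_add, evalEval_mul, evalEval_pow, evalEval_X,
      evalEval_C, eval_C, e, ← C_ofNat, Polynomial.map_mul, eval_mul]
    have h := congrArg ((↑) : ℝ → ℂ) (hxy t ht)
    push_cast at h ⊢
    linear_combination h
  intro g
  constructor
  · intro hg
    have hirr := irreducible_curvePoly ξ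
    rw [curvePoly_eq] at hirr h0 ⊢
    have hu : IsUnit (C (C ((phi : ℂ) ^ 10)) : ℂ[X][X]) :=
      ((isUnit_iff_ne_zero.2 (pow_ne_zero _ phi_ne_zero)).map C).map C
    rw [irreducible_isUnit_mul hu] at hirr
    rw [hu.mul_left_dvd]
    refine dvd_of_evalEval_eq_zero (biquadratic_monic _ _) hirr
      (S := (fun t => ((x t : ℂ), (y t : ℂ))) '' J) ?_ ?_ ?_
    · rintro _ ⟨t, ht, rfl⟩
      have := h0 t ht
      rw [evalEval_mul, evalEval_C, eval_C] at this
      exact (mul_eq_zero.1 this).resolve_left (pow_ne_zero _ phi_ne_zero)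
    · rw [Set.image_image]
      have := hinf.image (f := ((↑) : ℝ → ℂ)) Complex.ofReal_injective.injOn
      rwa [Set.image_image] at this
    · rintro _ ⟨t, ht, rfl⟩
      exact hg t ht
  · rintro ⟨k, rfl⟩ t ht
    rw [evalEval_mul, h0 t ht, zero_mul]

theorem upsilon_quad_curve {ξ : ℝ} (hξ₁ : -((2 + √5) / 5) < ξ) (hξ₂ : ξ < (2 + √5) / 27)
    {J : Set ℝ} {p q r : ℝ → ℝ} (hJ : IsOpen J) (hJc : J.OrdConnected) (hne : J.Nonempty)
    (h : IsSolution ξ J p q r) (h0 : ξ = 0 → ∀ t ∈ J, quad p q t ≠ 0) :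
    (∀ t ∈ J, quad p q t ≠ 0 ∧ DifferentiableAt ℝ (upsilon ξ (quad p q)) t ∧
      (deriv (upsilon ξ (quad p q)) t ^ 2 * phi ^ 5 + (lPoly ξ).eval (upsilon ξ (quad p q) t)
        * (tPoly ξ).eval (upsilon ξ (quad p q) t)) ^ 2
          = 4 * (tPoly ξ).eval (upsilon ξ (quad p q) t) ^ 3) ∧
    ((ξ = 0 → ¬ ∀ t ∈ J, ∀ s ∈ J, p t = p s ∧ q t = q s ∧ r t = r s) →
      Parametrizes (curvePoly ξ) J (upsilon ξ (quad p q)) (deriv (upsilon ξ (quad p q)))) := by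
  have hX : ∀ t ∈ J, quad p q t ≠ 0 := by
    intro t ht hz
    have h1 := h.quad_mul ht
    rw [hz, zero_mul, zero_mul] at h1
    exact h0 h1.symm t ht hz
  have hd : ∀ t ∈ J, HasDerivAt (upsilon ξ (quad p q))
      ((16 * phi - 48) * (p t * q t * r t) * vander p q r t) t := by
    intro t ht
    refine (h.hasDerivAt_sym ht).congr_of_eventuallyEq
      (Filter.eventually_of_mem (hJ.mem_nhds ht) fun s hs => h.upsilon_eq hs (hX s hs))
  have hrel : ∀ t ∈ J, (deriv (upsilon ξ (quad p q)) t ^ 2 * phi ^ 5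
      + (lPoly ξ).eval (upsilon ξ (quad p q) t) * (tPoly ξ).eval (upsilon ξ (quad p q) t)) ^ 2
          = 4 * (tPoly ξ).eval (upsilon ξ (quad p q) t) ^ 3 := by
    intro t ht
    rw [(hd t ht).deriv, h.upsilon_eq ht (hX t ht)]
    exact h.curve_relation ht
  refine ⟨fun t ht => ⟨hX t ht, (hd t ht).differentiableAt, hrel t ht⟩, fun hc => ?_⟩
  refine parametrizes_curvePoly ?_ hrel
  have : phi ^ 3 = 2 + √5 := by
    rw [phi_pow.2.1, sqrt_five_eq]; ring
  have hinf := h.sym_image_infinite hJ hJc hne (by rw [this]; linarith) (by rw [this]; linarith) hc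
  rwa [← Set.image_congr fun t ht => h.upsilon_eq ht (hX t ht)] at hinf

/-- The cyclic symmetry of the system carries the case of P to Q and R. -/
theorem upsilon_curve {ξ : ℝ} (hξ₁ : -((2 + √5) / 5) < ξ) (hξ₂ : ξ < (2 + √5) / 27)
    {J : Set ℝ} {p q r : ℝ → ℝ} (hJ : IsOpen J) (hJc : J.OrdConnected) (hne : J.Nonempty)
    (h : IsSolution ξ J p q r) {x : ℝ → ℝ} (hx : x = quad p q ∨ x = quad q r ∨ x = quad r p)
    (h0 : ξ = 0 → ∀ t ∈ J, x t ≠ 0) :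
    (∀ t ∈ J, x t ≠ 0 ∧ DifferentiableAt ℝ (upsilon ξ x) t ∧
      (deriv (upsilon ξ x) t ^ 2 * phi ^ 5 + (lPoly ξ).eval (upsilon ξ x t)
        * (tPoly ξ).eval (upsilon ξ x t)) ^ 2 = 4 * (tPoly ξ).eval (upsilon ξ x t) ^ 3) ∧
    ((ξ = 0 → ¬ ∀ t ∈ J, ∀ s ∈ J, p t = p s ∧ q t = q s ∧ r t = r s) →
      Parametrizes (curvePoly ξ) J (upsilon ξ x) (deriv (upsilon ξ x))) := by
  rcases hx with rfl | rfl | rfl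
  · exact upsilon_quad_curve hξ₁ hξ₂ hJ hJc hne h h0
  · have := upsilon_quad_curve hξ₁ hξ₂ hJ hJc hne h.rotate h0
    refine ⟨this.1, fun hc => this.2 fun hz hall => hc hz fun t ht s hs => ?_⟩
    have := hall t ht s hs
    tauto
  · have := upsilon_quad_curve hξ₁ hξ₂ hJ hJc hne h.rotate.rotate h0
    refine ⟨this.1, fun hc => this.2 fun hz hall => hc hz fun t ht s hs => ?_⟩
    have := hall t ht s hs
    tauto

end

/-! ### Smooth affine plane curves are normal -/

section

open Polynomial

/-- Taylor expansion of order one of a bivariate polynomial at the point `(a, b)`. -/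
theorem exists_expansion (F : ℂ[X][X]) (a b : ℂ) : ∃ (q : ℂ[X][X]) (r : ℂ[X]),
    F = (X - C (C b)) * q + C (X - C a) * C r + C (C (F.evalEval a b)) ∧
    q.evalEval a b = F.derivative.evalEval a b ∧ 
    r.eval a = (F.eval (C b)).derivative.eval a := by
  have hq := mul_divByMonic_eq_iff_isRoot.2 (show (F - C (F.eval (C b))).IsRoot (C b) by simp)
  have hr := mul_divByMonic_eq_iff_isRoot.2
    (show (F.eval (C b) - C ((F.eval (C b)).eval a)).IsRoot a by simp)
  refine ⟨(F - C (F.eval (C b))) /ₘ (X - C (C b)),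
    (F.eval (C b) - C ((F.eval (C b)).eval a)) /ₘ (X - C a), ?_, ?_, ?_⟩
  · rw [hq, ← C_mul, hr, evalEval]
    simp
  · have := congrArg (fun G => (derivative G).evalEval a b) hq
    simp only [derivative_mul, derivative_sub, derivative_X, derivative_C, sub_zero, one_mul,
      evalEval_add, evalEval_mul, evalEval_sub, evalEval_X, evalEval_C, eval_C, sub_self,
      zero_mul, add_zero] at this
    exact this
  · have := congrArg (fun G => (derivative G).eval a) hr
    simp only [derivative_mul, derivative_sub, derivative_X, derivative_C, sub_zero, one_mul,
      eval_add, eval_mul, eval_sub, eval_X, eval_C, sub_self,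
      zero_mul, add_zero] at this
    exact this

/-- A local domain which is Noetherian with principal maximal ideal is integrally closed. -/
theorem isIntegrallyClosed_of_principal {R : Type*} [CommRing R] [IsDomain R] [IsLocalRing R]
    [IsNoetherianRing R] (h : (IsLocalRing.maximalIdeal R).IsPrincipal) :
    IsIntegrallyClosed R :=
  have e : (IsIntegrallyClosed R ∧
      ∀ P : Ideal R, P ≠ ⊥ → P.IsPrime → P = IsLocalRing.maximalIdeal R) ↔
        (IsLocalRing.maximalIdeal R).IsPrincipal :=
    (tfae_of_isNoetherianRing_of_isLocalRing_of_isDomain R).out 3 4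
  (e.2 h).1

theorem isPrincipal_span_pair {R : Type*} [CommRing R] {x y α β : R} (h : α * x + β * y = 0)
    (hu : IsUnit α ∨ IsUnit β) : (Ideal.span {x, y}).IsPrincipal := by
  rcases hu with ⟨u, rfl⟩ | ⟨u, rfl⟩
  · refine ⟨y, le_antisymm ?_ ?_⟩
    · rw [Ideal.span_le]
      rintro z (rfl | rfl)
      · refine Ideal.mem_span_singleton'.2 ⟨-(↑u⁻¹ * β), ?_⟩
        linear_combination z * u.inv_mul - (↑u⁻¹ : R) * h
      · exact Ideal.mem_span_singleton_self _
    · exact Ideal.span_mono (by simp)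
  · refine ⟨x, le_antisymm ?_ ?_⟩
    · rw [Ideal.span_le]
      rintro z (rfl | rfl)
      · exact Ideal.mem_span_singleton_self _
      · refine Ideal.mem_span_singleton'.2 ⟨-(↑u⁻¹ * α), ?_⟩
        linear_combination z * u.inv_mul - (↑u⁻¹ : R) * h
    · exact Ideal.span_mono (by simp)

/-- The affine plane curve `F = 0` has no singular point. -/
def SmoothAffine (F : ℂ[X][X]) : Prop := ∀ a b : ℂ, F.evalEval a b = 0 →
  F.derivative.evalEval a b ≠ 0 ∨ (F.eval (C b)).derivative.eval a ≠ 0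

/-- The coordinate ring of a smooth affine plane curve is integrally closed. -/
theorem isIntegrallyClosed_adjoinRoot (F : ℂ[X][X]) [IsDomain (AdjoinRoot F)]
    (hs : SmoothAffine F) : IsIntegrallyClosed (AdjoinRoot F) := by
  refine IsIntegrallyClosed.of_localization_maximal fun m _ hm => ?_
  apply isIntegrallyClosed_of_principal
  let A := AdjoinRoot F
  let := Ideal.Quotient.field m
  -- Nullstellensatz: the residue field is ℂ, so m is the ideal of a point (a, b) of the curve.
  have : Module.Finite ℂ (A ⧸ m) := finite_of_finite_type_of_isJacobsonRing ℂ (A ⧸ m)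
  have hbij : Function.Bijective (algebraMap ℂ (A ⧸ m)) :=
    IsAlgClosed.algebraMap_bijective_of_isIntegral
  let π : ℂ[X][X] →+* (A ⧸ m) := (Ideal.Quotient.mk m).comp (AdjoinRoot.mk F)
  have hπC : ∀ c : ℂ, π (C (C c)) = algebraMap ℂ (A ⧸ m) c := fun c => rfl
  obtain ⟨a, ha⟩ := hbij.2 (π (C X))
  obtain ⟨b, hb⟩ := hbij.2 (π X)
  have hxa : π (C (X - C a)) = 0 := by rw [C_sub, map_sub, hπC, ha, sub_self]
  have hyb : π (X - C (C b)) = 0 := by rw [map_sub, hπC, hb, sub_self]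
  have hπ : ∀ G : ℂ[X][X], π G = algebraMap ℂ (A ⧸ m) (G.evalEval a b) := by
    intro G
    obtain ⟨q, r, hG, -, -⟩ := exists_expansion G a b
    conv_lhs => rw [hG]
    rw [map_add, map_add, map_mul, map_mul, hxa, hyb, hπC]; simp
  have hker : ∀ G : ℂ[X][X], AdjoinRoot.mk F G ∈ m ↔ G.evalEval a b = 0 := by
    intro G
    rw [← Ideal.Quotient.eq_zero_iff_mem, ← map_eq_zero_iff _ hbij.1, ← hπ]; rfl
  have hF0 : F.evalEval a b = 0 := by
    rw [← hker, AdjoinRoot.mk_self]; exact m.zero_mem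
  have hmspan : m = Ideal.span {AdjoinRoot.mk F (C (X - C a)), AdjoinRoot.mk F (X - C (C b))} := by
    apply le_antisymm
    · intro z hz
      obtain ⟨G, rfl⟩ := AdjoinRoot.mk_surjective z
      obtain ⟨q, r, hG, -, -⟩ := exists_expansion G a b
      rw [(hker G).1 hz, C_0, C_0, add_zero] at hG
      rw [hG, map_add, map_mul, map_mul, Ideal.mem_span_pair]
      exact ⟨AdjoinRoot.mk F (C r), AdjoinRoot.mk F q, by ring⟩
    · rw [Ideal.span_le]
      rintro z (rfl | rfl)
      · exact (hker _).2 (by simp [evalEval_C])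
      · exact (hker _).2 (by simp [evalEval_sub, evalEval_X, evalEval_C])
  obtain ⟨q, r, hF, hq, hr⟩ := exists_expansion F a b
  rw [← Localization.AtPrime.map_eq_maximalIdeal]
  have hunit : ∀ G : ℂ[X][X], G.evalEval a b ≠ 0 →
      IsUnit (algebraMap A (Localization.AtPrime m) (AdjoinRoot.mk F G)) := by
    intro G hG
    exact IsLocalization.map_units (Localization.AtPrime m)
      (⟨AdjoinRoot.mk F G, fun h => hG ((hker G).1 h)⟩ : m.primeCompl)
  have hrel : algebraMap A (Localization.AtPrime m) (AdjoinRoot.mk F (C r))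
        * algebraMap A (Localization.AtPrime m) (AdjoinRoot.mk F (C (X - C a)))
      + algebraMap A (Localization.AtPrime m) (AdjoinRoot.mk F q)
        * algebraMap A (Localization.AtPrime m) (AdjoinRoot.mk F (X - C (C b))) = 0 := by
    have : C r * C (X - C a) + q * (X - C (C b)) = F := by
      conv_rhs => rw [hF, hF0, C_0, C_0]
      ring
    have := congrArg ((algebraMap A (Localization.AtPrime m)).comp (AdjoinRoot.mk F)) this
    rw [map_add, map_mul, map_mul] at this
    refine this.trans ?_
    rw [RingHom.comp_apply, AdjoinRoot.mk_self, map_zero]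
  -- The Taylor expansion of F = 0 relates the two generators of m, and smoothness makes one
  -- coefficient a unit of the local ring. One generator is then redundant.
  have hp := isPrincipal_span_pair hrel (by
    rcases hs a b hF0 with h | h
    · exact Or.inr (hunit q (by rwa [hq]))
    · exact Or.inl (hunit (C r) (by rwa [evalEval_C, hr])))
  have hmap : Ideal.map (algebraMap A (Localization.AtPrime m)) m = _ :=
    congrArg (Ideal.map (algebraMap A (Localization.AtPrime m))) hmspan
  rw [Ideal.map_span, Set.image_pair] at hmap
  rwa [hmap]

end

/-! ### Integral closures of ℂ[x] and ℂ[x, x⁻¹] -/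

section

open Polynomial

section Closure
variable {K : Type*} [Field K] [Algebra ℂ K]

theorem mem_integralOver {s : Set K} {z : K} :
    z ∈ integralOver s ↔ IsIntegral (Algebra.adjoin ℂ s) z := Iff.rfl

theorem isIntegralElem_of_surjective {R S T : Type*} [CommRing R] [CommRing S] [CommRing T]
    (f : R →+* S) (g : S →+* T) (hf : Function.Surjective f) {z : T} (hz : g.IsIntegralElem z) :
    (g.comp f).IsIntegralElem z := by
  obtain ⟨p, hp, hpz⟩ := hz
  have hl : p ∈ Polynomial.lifts f := by
    obtain ⟨q, hq⟩ := Polynomial.map_surjective f hf p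
    exact (Polynomial.mem_lifts p).2 ⟨q, hq⟩
  obtain ⟨q, hq, -, hqm⟩ := Polynomial.lifts_and_natDegree_eq_and_monic hl hp
  refine ⟨q, hqm, ?_⟩
  rw [← Polynomial.eval₂_map, hq, hpz]

theorem isIntegralElem_aeval_of_mem {x z : K} (hz : z ∈ integralOver {x}) :
    (aeval x : ℂ[X] →ₐ[ℂ] K).toRingHom.IsIntegralElem z := by
  have hz' : (algebraMap (Algebra.adjoin ℂ {x}) K).IsIntegralElem z := mem_integralOver.1 hz
  have hmem : ∀ p : ℂ[X], aeval x p ∈ Algebra.adjoin ℂ {x} := fun p => by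
    rw [Algebra.adjoin_singleton_eq_range_aeval]; exact ⟨p, rfl⟩
  let f : ℂ[X] →ₐ[ℂ] Algebra.adjoin ℂ {x} := (aeval x).codRestrict _ hmem
  have hf : Function.Surjective f := by
    rintro ⟨y, hy⟩
    have hy' := hy
    rw [Algebra.adjoin_singleton_eq_range_aeval] at hy'
    obtain ⟨p, hp⟩ := hy'
    exact ⟨p, Subtype.ext hp⟩
  exact isIntegralElem_of_surjective f.toRingHom _ hf hz'

/-- The coordinate ring of a smooth affine curve, monic in the second variable, is the integral
closure of the polynomial ring in the first coordinate function. -/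
theorem integralOver_eq_span {F : ℂ[X][X]} {d : ℕ} (hd : F.natDegree = d) (hm : F.Monic)
    (hirr : Irreducible F)
    (hs : SmoothAffine F) {x w : K} (hx : Transcendental ℂ x)
    (hF : F.eval₂ (aeval x : ℂ[X] →ₐ[ℂ] K).toRingHom w = 0)
    (hK : ∀ z : K, ∃ a ∈ Algebra.adjoin ℂ {x, w}, ∃ b ∈ Algebra.adjoin ℂ {x, w}, z = a / b) :
    LinearIndependent ℂ (fun ij : ℕ × Fin d => x ^ ij.1 * w ^ (ij.2 : ℕ)) ∧
    Subalgebra.toSubmodule (integralOver {x}) =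
      Submodule.span ℂ (Set.range fun ij : ℕ × Fin d => x ^ ij.1 * w ^ (ij.2 : ℕ)) := by
  subst hd
  have hdom : IsDomain (AdjoinRoot F) := AdjoinRoot.isDomain_of_prime hirr.prime
  have hfin : Module.Finite ℂ[X] (AdjoinRoot F) := hm.finite_adjoinRoot
  have hic := isIntegrallyClosed_adjoinRoot F hs
  let j : AdjoinRoot F →ₐ[ℂ] K := AdjoinRoot.liftAlgHom F (aeval x) w hF
  have jX : ∀ p : ℂ[X], j (AdjoinRoot.of F p) = aeval x p := fun p =>
    AdjoinRoot.liftAlgHom_of F (aeval x) w hF p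
  have jr : j (AdjoinRoot.root F) = w := AdjoinRoot.liftAlgHom_root F (aeval x) w hF
  have hinj : Function.Injective j := by
    rw [injective_iff_map_eq_zero]
    -- In a domain integral over ℂ[X], a nonzero ideal meets ℂ[X] nontrivially; the transcendence of
    -- x excludes this for the kernel.
    have hker : RingHom.ker j = ⊥ := by
      apply Ideal.eq_bot_of_comap_eq_bot (R := ℂ[X])
      rw [eq_bot_iff]
      intro p hp
      rw [Ideal.mem_comap, RingHom.mem_ker, AdjoinRoot.algebraMap_eq, jX] at hp
      exact (transcendental_iff.1 hx) p hp
    intro a ha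
    have : a ∈ RingHom.ker j := ha
    rwa [hker] at this
  let B : Module.Basis (ℕ × Fin F.natDegree) ℂ (AdjoinRoot F) :=
    (Polynomial.basisMonomials ℂ).smulTower ((AdjoinRoot.powerBasis' hm).basis.reindex
      (finCongr (AdjoinRoot.powerBasis'_dim hm)))
  have hB : ∀ ij : ℕ × Fin F.natDegree, j (B ij) = x ^ ij.1 * w ^ (ij.2 : ℕ) := by
    intro ij
    have : B ij = AdjoinRoot.of F (X ^ ij.1) * AdjoinRoot.root F ^ (ij.2 : ℕ) := by
      simp [B, Module.Basis.smulTower_apply, Algebra.smul_def, AdjoinRoot.algebraMap_eq,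
        ← Polynomial.X_pow_eq_monomial]
    rw [this, map_mul, map_pow j, jX, jr]
    simp
  have hfun : (fun ij : ℕ × Fin F.natDegree => x ^ ij.1 * w ^ (ij.2 : ℕ)) = j ∘ B :=
    funext fun ij => (hB ij).symm
  rw [hfun]
  refine ⟨B.linearIndependent.map' j.toLinearMap (LinearMap.ker_eq_bot.2 hinj), ?_⟩
  have hspan : Submodule.span ℂ (Set.range (j ∘ B)) = LinearMap.range j.toLinearMap := by
    rw [Set.range_comp, ← AlgHom.coe_toLinearMap, ← Submodule.map_span, B.span_eq, Submodule.map_top]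
  rw [hspan]
  apply le_antisymm
  · intro z hz
    have hz1 := isIntegralElem_aeval_of_mem (x := x) (z := z) hz
    let := j.toRingHom.toAlgebra
    have hfaith : FaithfulSMul (AdjoinRoot F) K := (faithfulSMul_iff_algebraMap_injective _ _).2 hinj
    have hadj : ∀ a ∈ Algebra.adjoin ℂ {x, w}, a ∈ j.range := by
      intro a ha
      refine (Algebra.adjoin_le (S := j.range) ?_) ha
      rintro y (rfl | rfl)
      · exact ⟨AdjoinRoot.of F X, by change j _ = _; rw [jX, aeval_X]⟩
      · exact ⟨AdjoinRoot.root F, jr⟩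
    have hfrac : IsFractionRing (AdjoinRoot F) K := by
      refine IsFractionRing.of_field _ _ fun z => ?_
      obtain ⟨a, ha, b, hb, h⟩ := hK z
      obtain ⟨a, rfl⟩ := hadj a ha
      obtain ⟨b, rfl⟩ := hadj b hb
      exact ⟨a, b, h⟩
    have hz2 : IsIntegral (AdjoinRoot F) z := by
      obtain ⟨p, hp, hpz⟩ := hz1
      refine ⟨p.map (AdjoinRoot.of F), hp.map _, ?_⟩
      rw [Polynomial.eval₂_map]
      have : (algebraMap (AdjoinRoot F) K).comp (AdjoinRoot.of F)
          = (aeval x : ℂ[X] →ₐ[ℂ] K).toRingHom := RingHom.ext jX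
      rwa [this]
    obtain ⟨a, ha⟩ := IsIntegrallyClosed.isIntegral_iff.1 hz2
    exact ⟨a, ha⟩
  · rw [← hspan, Submodule.span_le]
    rintro _ ⟨ij, rfl⟩
    have hxm : x ∈ integralOver {x} := mem_integralOver.2
      (isIntegral_algebraMap (R := Algebra.adjoin ℂ {x}) (x := ⟨x, Algebra.self_mem_adjoin_singleton ℂ x⟩))
    have hwm : w ∈ integralOver {x} := by
      rw [mem_integralOver]
      have hmem : ∀ p : ℂ[X], aeval x p ∈ Algebra.adjoin ℂ {x} := fun p => by
        rw [Algebra.adjoin_singleton_eq_range_aeval]; exact ⟨p, rfl⟩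
      let f : ℂ[X] →ₐ[ℂ] Algebra.adjoin ℂ {x} := (aeval x).codRestrict _ hmem
      refine ⟨F.map f.toRingHom, hm.map _, ?_⟩
      rw [Polynomial.eval₂_map]
      exact hF
    have := mul_mem (pow_mem hxm ij.1) (pow_mem hwm (ij.2 : ℕ))
    rw [Function.comp_apply, hB]
    exact this

/-- The hypotheses make S the localization of R at the powers of x, so denominators in an integral
equation over S can be cleared. -/
theorem exists_pow_mul_isIntegralElem {R S T : Type*} [CommRing R] [CommRing S] [CommRing T]
    (f : R →+* S) (g : S →+* T) (x : R) (hx : IsUnit (f x)) (hinj : Function.Injective f)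
    (hS : ∀ s : S, ∃ (n : ℕ) (r : R), s * f x ^ n = f r) {z : T}
    (hz : g.IsIntegralElem z) : ∃ n : ℕ, (g.comp f).IsIntegralElem (g (f x) ^ n * z) := by
  let := f.toAlgebra
  let := g.toAlgebra
  let := (g.comp f).toAlgebra
  have htower : IsScalarTower R S T := IsScalarTower.of_algebraMap_eq fun a => rfl
  have hloc : IsLocalization (Submonoid.powers x) S := by
    refine ⟨⟨?_, ?_, ?_⟩⟩
    · rintro ⟨_, n, rfl⟩
      rw [map_pow]
      exact hx.pow n
    · intro s
      obtain ⟨n, r, h⟩ := hS s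
      exact ⟨⟨r, ⟨x ^ n, n, rfl⟩⟩, (congrArg (s * ·) (map_pow f x n)).trans h⟩
    · intro a b hab
      exact ⟨1, by rw [hinj hab]⟩
  have hz' : IsIntegral S z := hz
  obtain ⟨⟨_, n, rfl⟩, hm⟩ :=
    hz'.exists_multiple_integral_of_isLocalization (Submonoid.powers x) (R := R)
  refine ⟨n, ?_⟩
  rw [Submonoid.smul_def, Algebra.smul_def, map_pow] at hm
  exact hm

theorem exists_mul_pow_mem_adjoin {x : K} (hx : x ≠ 0) {s : K}
    (hs : s ∈ Algebra.adjoin ℂ {x, x⁻¹}) : ∃ n : ℕ, s * x ^ n ∈ Algebra.adjoin ℂ {x} := by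
  have hxm : x ∈ Algebra.adjoin ℂ {x} := Algebra.self_mem_adjoin_singleton ℂ x
  induction hs using Algebra.adjoin_induction with
  | mem y hy =>
    rcases hy with rfl | rfl
    · exact ⟨0, by simp⟩
    · exact ⟨1, by simp [hx]⟩
  | algebraMap r => exact ⟨0, by simp⟩
  | add a b _ _ ha hb =>
    obtain ⟨n, hn⟩ := ha
    obtain ⟨m, hm⟩ := hb
    refine ⟨n + m, ?_⟩
    rw [show (a + b) * x ^ (n + m) = (a * x ^ n) * x ^ m + (b * x ^ m) * x ^ n by ring]
    exact add_mem (mul_mem hn (pow_mem hxm m)) (mul_mem hm (pow_mem hxm n))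
  | mul a b _ _ ha hb =>
    obtain ⟨n, hn⟩ := ha
    obtain ⟨m, hm⟩ := hb
    refine ⟨n + m, ?_⟩
    rw [show a * b * x ^ (n + m) = (a * x ^ n) * (b * x ^ m) by ring]
    exact mul_mem hn hm

theorem exists_pow_mul_mem_integralOver {x z : K} (hx : x ≠ 0) (hz : z ∈ integralOver {x, x⁻¹}) :
    ∃ n : ℕ, x ^ n * z ∈ integralOver {x} := by
  have hle : Algebra.adjoin ℂ {x} ≤ Algebra.adjoin ℂ {x, x⁻¹} := Algebra.adjoin_mono (by simp)
  have hxm : x ∈ Algebra.adjoin ℂ {x} := Algebra.self_mem_adjoin_singleton ℂ x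
  have hcomp : (Algebra.adjoin ℂ {x, x⁻¹}).val.toRingHom.comp
      (Subalgebra.inclusion hle).toRingHom = algebraMap (Algebra.adjoin ℂ {x}) K := rfl
  have hunit : IsUnit ((Subalgebra.inclusion hle).toRingHom ⟨x, hxm⟩) := by
    refine IsUnit.of_mul_eq_one (⟨x⁻¹, Algebra.subset_adjoin (by simp)⟩ :
      Algebra.adjoin ℂ {x, x⁻¹}) ?_
    exact Subtype.ext (by simp [hx])
  have hS : ∀ s : Algebra.adjoin ℂ {x, x⁻¹}, ∃ (n : ℕ) (r : Algebra.adjoin ℂ {x}),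
      s * (Subalgebra.inclusion hle).toRingHom ⟨x, hxm⟩ ^ n
        = (Subalgebra.inclusion hle).toRingHom r := by
    intro s
    obtain ⟨n, hn⟩ := exists_mul_pow_mem_adjoin hx s.2
    exact ⟨n, ⟨_, hn⟩, Subtype.ext (by simp)⟩
  obtain ⟨n, hn⟩ := exists_pow_mul_isIntegralElem (Subalgebra.inclusion hle).toRingHom
    (Algebra.adjoin ℂ {x, x⁻¹}).val.toRingHom ⟨x, hxm⟩ hunit
    (Subalgebra.inclusion_injective hle) hS (mem_integralOver.1 hz)
  rw [hcomp] at hn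
  exact ⟨n, hn⟩

end Closure

end

/-! ### Čech cohomology read off from a free family -/

section Cech
variable {K : Type*} [CommRing K] [Algebra ℂ K] {ι : Type*} {v : ι → K} {x : K} {S₀ S₁ : Set ι}

theorem inclusion_sub_apply {A B U : Subalgebra ℂ K} (hA : A ≤ U) (hB : B ≤ U) (a : A) (b : B) :
    ((((Subalgebra.inclusion hB).toLinearMap ∘ₗ LinearMap.snd ℂ A B
      - (Subalgebra.inclusion hA).toLinearMap ∘ₗ LinearMap.fst ℂ A B) (a, b) : U) : K) = b - a := by
  simp

theorem cechDiff_apply (a : integralOver {x}) (b : integralOver {Ring.inverse x}) :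
    (cechDiff x (a, b) : K) = b - a :=
  inclusion_sub_apply (integralOver_mono (by simp)) (integralOver_mono (by simp)) a b

theorem span_image_inter (hv : LinearIndependent ℂ v) (S T : Set ι) :
    Submodule.span ℂ (v '' S) ⊓ Submodule.span ℂ (v '' T) = Submodule.span ℂ (v '' (S ∩ T)) := by
  apply le_antisymm
  · rintro z ⟨hS, hT⟩
    obtain ⟨l, hl, rfl⟩ := (Finsupp.mem_span_image_iff_linearCombination ℂ).1 hS
    obtain ⟨m, hm, hml⟩ := (Finsupp.mem_span_image_iff_linearCombination ℂ).1 hT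
    obtain rfl := hv hml
    refine (Finsupp.mem_span_image_iff_linearCombination ℂ).2 ⟨m, ?_, rfl⟩
    rw [Finsupp.supported_inter]
    exact ⟨hl, hm⟩
  · exact le_inf (Submodule.span_mono (Set.image_mono Set.inter_subset_left))
      (Submodule.span_mono (Set.image_mono Set.inter_subset_right))

/-- `dim H⁰` of the Čech complex, when the two rings are spanned by parts of a free family. -/
theorem finrank_ker_cechDiff (hv : LinearIndependent ℂ v)
    (h₀ : Subalgebra.toSubmodule (integralOver {x}) = Submodule.span ℂ (v '' S₀))
    (h₁ : Subalgebra.toSubmodule (integralOver {Ring.inverse x}) = Submodule.span ℂ (v '' S₁)) :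
    Module.finrank ℂ (LinearMap.ker (cechDiff x)) = Nat.card ↥(S₀ ∩ S₁) := by
  let φ : LinearMap.ker (cechDiff x) →ₗ[ℂ] K :=
    (integralOver {x}).val.toLinearMap ∘ₗ LinearMap.fst ℂ _ _ ∘ₗ Submodule.subtype _
  have hker : ∀ z : LinearMap.ker (cechDiff x), (z.1.1 : K) = z.1.2 := by
    intro z
    have h := congrArg (Subtype.val) (LinearMap.mem_ker.1 z.2)
    rw [← Prod.mk.eta (p := z.1), cechDiff_apply, ZeroMemClass.coe_zero] at h
    exact (sub_eq_zero.1 h).symm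
  have hinj : Function.Injective φ := by
    intro z w hzw
    have h1 : (z.1.1 : K) = w.1.1 := hzw
    have h2 : (z.1.2 : K) = w.1.2 := by rw [← hker, ← hker, h1]
    exact Subtype.ext (Prod.ext (Subtype.ext h1) (Subtype.ext h2))
  have hrange : LinearMap.range φ = Submodule.span ℂ (Set.range fun i : ↥(S₀ ∩ S₁) => v i) := by
    rw [← Set.image_eq_range, ← span_image_inter hv, ← h₀, ← h₁]
    apply le_antisymm
    · rintro _ ⟨z, rfl⟩
      refine ⟨z.1.1.2, ?_⟩
      have : φ z = z.1.2 := hker z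
      rw [this]
      exact z.1.2.2
    · rintro z ⟨h, h'⟩
      refine ⟨⟨(⟨z, h⟩, ⟨z, h'⟩), ?_⟩, rfl⟩
      rw [LinearMap.mem_ker]
      apply Subtype.ext
      rw [cechDiff_apply, ZeroMemClass.coe_zero, sub_self]
  have hli : LinearIndependent ℂ fun i : ↥(S₀ ∩ S₁) => v i := hv.comp _ Subtype.val_injective
  rw [← LinearMap.finrank_range_of_inj hinj, hrange,
    Module.finrank_eq_nat_card_basis (Module.Basis.span hli)]

/-- `dim H¹` of the Čech complex, when the three rings are spanned by parts of a free family. -/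
theorem finrank_coker_cechDiff (hv : LinearIndependent ℂ v)
    (h₀ : Subalgebra.toSubmodule (integralOver {x}) = Submodule.span ℂ (v '' S₀))
    (h₁ : Subalgebra.toSubmodule (integralOver {Ring.inverse x}) = Submodule.span ℂ (v '' S₁))
    (h : Subalgebra.toSubmodule (integralOver {x, Ring.inverse x})
      = Submodule.span ℂ (Set.range v)) :
    Module.finrank ℂ (integralOver {x, Ring.inverse x} ⧸ LinearMap.range (cechDiff x))
      = Nat.card ↥(S₀ ∪ S₁)ᶜ := by
  let e : integralOver {x, Ring.inverse x} ≃ₗ[ℂ] (ι →₀ ℂ) :=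
    (LinearEquiv.ofEq _ _ h).trans hv.linearCombinationEquiv.symm
  have he : ∀ z, Finsupp.linearCombination ℂ v (e z) = z := fun z =>
    hv.linearCombination_repr _
  -- Keeping only the coordinates outside S₀ ∪ S₁ is a surjection whose kernel is the image of the
  -- differential.
  let L : integralOver {x, Ring.inverse x} →ₗ[ℂ] (↥(S₀ ∪ S₁)ᶜ →₀ ℂ) :=
    Finsupp.lsubtypeDomain _ ∘ₗ e.toLinearMap
  have hL : Function.Surjective L := by
    intro l
    refine ⟨e.symm (l.embDomain (Function.Embedding.subtype _)), ?_⟩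
    ext i
    have : L (e.symm (l.embDomain (Function.Embedding.subtype _))) i
        = (e (e.symm (l.embDomain (Function.Embedding.subtype _)))) i := rfl
    rw [this, LinearEquiv.apply_symm_apply]
    exact Finsupp.embDomain_apply_self _ l i
  have hmem : ∀ z, z ∈ LinearMap.ker L ↔ (z : K) ∈ Submodule.span ℂ (v '' (S₀ ∪ S₁)) := by
    intro z
    rw [LinearMap.mem_ker]
    constructor
    · intro hz
      refine (Finsupp.mem_span_image_iff_linearCombination ℂ).2 ⟨e z, ?_, he z⟩
      rw [Finsupp.mem_supported']
      intro i hi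
      exact DFunLike.congr_fun hz (⟨i, hi⟩ : ↥(S₀ ∪ S₁)ᶜ)
    · intro hz
      obtain ⟨l, hl, hlz⟩ := (Finsupp.mem_span_image_iff_linearCombination ℂ).1 hz
      obtain rfl : l = e z := hv (hlz.trans (he z).symm)
      ext i
      exact (Finsupp.mem_supported' ℂ _).1 hl i i.2
  have hker : LinearMap.range (cechDiff x) = LinearMap.ker L := by
    ext z
    rw [hmem, Set.image_union, Submodule.span_union, ← h₀, ← h₁, Submodule.mem_sup]
    constructor
    · rintro ⟨⟨a, b⟩, rfl⟩
      exact ⟨-a, neg_mem a.2, b, b.2, by rw [cechDiff_apply]; ring⟩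
    · rintro ⟨a, ha, b, hb, hab⟩
      refine ⟨(⟨-a, neg_mem ha⟩, ⟨b, hb⟩), Subtype.ext ?_⟩
      rw [cechDiff_apply, ← hab]
      ring
  rw [hker, (L.quotKerEquivOfSurjective hL).finrank_eq,
    Module.finrank_eq_nat_card_basis Finsupp.basisSingleOne]

end Cech

/-! ### Laurent monomials in the two charts -/

section Laurent
variable {K : Type*} [Field K] [Algebra ℂ K] {x w : K} {d : ℕ}

/-- The family `xⁿ wⁱ`, `n ∈ ℤ`, `i < d`. -/
def laurentFamily (x w : K) (d : ℕ) (ij : ℤ × Fin d) : K := x ^ ij.1 * w ^ (ij.2 : ℕ)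

/-- Finitely many Laurent monomials become ordinary ones after multiplication by a common power of
x. -/
theorem linearIndependent_laurentFamily (hx : x ≠ 0)
    (h : LinearIndependent ℂ (fun ij : ℕ × Fin d => x ^ ij.1 * w ^ (ij.2 : ℕ))) :
    LinearIndependent ℂ (laurentFamily x w d) := by
  rw [linearIndependent_iff_finset_linearIndependent]
  intro s
  obtain ⟨N, hN⟩ : ∃ N : ℕ, ∀ ij ∈ s, 0 ≤ ij.1 + N := by
    refine ⟨s.sup fun ij => ij.1.natAbs, fun ij hij => ?_⟩
    have : ij.1.natAbs ≤ s.sup fun ij => ij.1.natAbs := Finset.le_sup (f := fun ij : ℤ × Fin d => ij.1.natAbs) hij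
    omega
  let f : s → ℕ × Fin d := fun ij => ((ij.1.1 + N).toNat, ij.1.2)
  have hf : Function.Injective f := by
    rintro ⟨⟨a, i⟩, ha⟩ ⟨⟨b, k⟩, hb⟩ hab
    simp only [f, Prod.mk.injEq] at hab
    have h1 := hN _ ha
    have h2 := hN _ hb
    simp only at h1 h2
    obtain ⟨h3, rfl⟩ := hab
    obtain rfl : a = b := by omega
    rfl
  have h1 := (h.comp f hf).map' (LinearMap.mulLeft ℂ (x ^ (-(N : ℤ)))) (by
    rw [LinearMap.ker_eq_bot]
    exact mul_right_injective₀ (zpow_ne_zero _ hx))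
  have hfun : (LinearMap.mulLeft ℂ (x ^ (-(N : ℤ)))) ∘
      (fun ij : ℕ × Fin d => x ^ ij.1 * w ^ (ij.2 : ℕ)) ∘ f
        = laurentFamily x w d ∘ (Subtype.val : s → ℤ × Fin d) := ?_
  · rw [← hfun]; exact h1
  funext ij
  have : (((ij.1.1 + N).toNat : ℕ) : ℤ) = ij.1.1 + N := Int.toNat_of_nonneg (hN _ ij.2)
  simp only [Function.comp_apply, LinearMap.mulLeft_apply, f, laurentFamily]
  rw [← mul_assoc, ← zpow_natCast x, this, ← zpow_add₀ hx]
  congr 2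
  ring

theorem span_laurentFamily_nonneg :
    Submodule.span ℂ (Set.range fun ij : ℕ × Fin d => x ^ ij.1 * w ^ (ij.2 : ℕ))
      = Submodule.span ℂ (laurentFamily x w d '' {ij | 0 ≤ ij.1}) := by
  congr 1
  ext z
  constructor
  · rintro ⟨⟨n, i⟩, rfl⟩
    exact ⟨(n, i), Int.natCast_nonneg n, by simp [laurentFamily]⟩
  · rintro ⟨⟨n, i⟩, hn, rfl⟩
    refine ⟨(n.toNat, i), ?_⟩
    simp only [laurentFamily]
    rw [← zpow_natCast x, Int.toNat_of_nonneg hn]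

/-- Each factor w/x costs one power of x, hence the slanted bound on the exponent. This makes h¹
nonzero. -/
theorem span_laurentFamily_infinity (hx : x ≠ 0) :
    Submodule.span ℂ (Set.range fun ij : ℕ × Fin d => x⁻¹ ^ ij.1 * (w * x⁻¹) ^ (ij.2 : ℕ))
      = Submodule.span ℂ (laurentFamily x w d '' {ij | ij.1 ≤ -(ij.2 : ℤ)}) := by
  have key : ∀ (n i : ℕ), x⁻¹ ^ n * (w * x⁻¹) ^ i = x ^ (-(n : ℤ) - i) * w ^ i := by
    intro n i
    rw [zpow_sub₀ hx, zpow_neg, zpow_natCast, zpow_natCast, mul_pow, inv_pow, inv_pow]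
    ring
  congr 1
  ext z
  constructor
  · rintro ⟨⟨n, i⟩, rfl⟩
    exact ⟨(-(n : ℤ) - (i : ℕ), i), by simp, by simp only [laurentFamily]; rw [key]⟩
  · rintro ⟨⟨n, i⟩, hn, rfl⟩
    simp only [Set.mem_ofPred_eq] at hn
    refine ⟨((-n - (i : ℕ)).toNat, i), ?_⟩
    simp only [laurentFamily]
    rw [key, Int.toNat_of_nonneg (by omega)]
    congr 2
    ring

theorem mem_integralOver_self {s : Set K} {z : K} (hz : z ∈ s) : z ∈ integralOver s :=
  mem_integralOver.2 (isIntegral_algebraMap (R := Algebra.adjoin ℂ s)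
    (x := ⟨z, Algebra.subset_adjoin hz⟩))

theorem integralOver_pair_eq_span (hx : x ≠ 0) (hw : w ∈ integralOver {x})
    (h₀ : Subalgebra.toSubmodule (integralOver {x})
      = Submodule.span ℂ (laurentFamily x w d '' {ij | 0 ≤ ij.1})) :
    Subalgebra.toSubmodule (integralOver {x, x⁻¹})
      = Submodule.span ℂ (Set.range (laurentFamily x w d)) := by
  apply le_antisymm
  · intro z hz
    obtain ⟨n, hn⟩ := exists_pow_mul_mem_integralOver hx hz
    have hn' : x ^ n * z ∈ Submodule.span ℂ (Set.range (laurentFamily x w d)) := by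
      have : x ^ n * z ∈ Subalgebra.toSubmodule (integralOver {x}) := hn
      rw [h₀] at this
      exact Submodule.span_mono (Set.image_subset_range _ _) this
    have hmap := Submodule.mem_map_of_mem (f := LinearMap.mulLeft ℂ (x ^ (-(n : ℤ)))) hn'
    rw [Submodule.map_span] at hmap
    have hz' : LinearMap.mulLeft ℂ (x ^ (-(n : ℤ))) (x ^ n * z) = z := by
      rw [LinearMap.mulLeft_apply, zpow_neg, zpow_natCast, inv_mul_cancel_left₀ (pow_ne_zero _ hx)]
    rw [hz'] at hmap
    refine Submodule.span_mono ?_ hmap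
    rintro _ ⟨_, ⟨⟨m, i⟩, rfl⟩, rfl⟩
    refine ⟨(-(n : ℤ) + m, i), ?_⟩
    simp only [laurentFamily, LinearMap.mulLeft_apply]
    rw [zpow_add₀ hx, mul_assoc]
  · rw [Submodule.span_le]
    rintro _ ⟨⟨m, i⟩, rfl⟩
    have hw' : w ∈ integralOver {x, x⁻¹} := integralOver_mono (by simp) hw
    refine mul_mem (S := Subalgebra ℂ K) ?_ (pow_mem hw' _)
    rcases m.eq_nat_or_neg with ⟨k, h | h⟩
    · simp only [h, zpow_natCast]
      exact pow_mem (mem_integralOver_self (by simp)) _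
    · simp only [h, zpow_neg, zpow_natCast, ← inv_pow]
      exact pow_mem (mem_integralOver_self (by simp)) _

end Laurent

/-! ### The quartic (w² + 𝔩)² = 4𝔱 and its smoothness -/

section

open Polynomial

theorem not_isSquare_of_simple_root {p : ℂ[X]} {a : ℂ} (ha : p.eval a = 0)
    (hp : p.derivative.eval a ≠ 0) : ¬ IsSquare p := by
  rintro ⟨q, rfl⟩
  rw [eval_mul, mul_self_eq_zero] at ha
  simp [derivative_mul, ha] at hp

/-- All roots of `p` are simple. -/
def SimpleRoots (p : ℂ[X]) : Prop := ∀ a, p.eval a = 0 → p.derivative.eval a ≠ 0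

/-- The equation is (Y² + m)² = 4n, with Y-derivative 4Y(Y² + m). A singular point with Y = 0 gives
a multiple root of m² - 4n, and one with Y² = -m a multiple root of n. -/
theorem smoothAffine_biquadratic {m n : ℂ[X]} (hn : SimpleRoots n)
    (hc : SimpleRoots (m ^ 2 - 4 * n)) : SmoothAffine (biquadratic (2 * m) (m ^ 2 - 4 * n)) := by
  intro a b h
  by_contra! hsing
  obtain ⟨h1, h2⟩ := hsing
  simp only [biquadratic, evalEval_add, evalEval_mul, evalEval_pow, evalEval_X, evalEval_C,
    eval_mul, eval_sub, eval_pow, eval_ofNat] at h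
  simp only [biquadratic, derivative_add, derivative_C_mul, derivative_X_pow, derivative_C,
    evalEval_add, evalEval_mul, evalEval_pow, evalEval_X, evalEval_C,
    eval_mul, eval_ofNat, add_zero] at h1
  simp [biquadratic, eval_add, eval_mul, eval_pow, eval_X, eval_C, derivative_add,
    derivative_mul, derivative_sub, derivative_pow, derivative_C] at h2
  have hc1 : (m ^ 2 - 4 * n).eval a = m.eval a ^ 2 - 4 * n.eval a := by simp
  have hc2 : (m ^ 2 - 4 * n).derivative.eval a
      = 2 * m.eval a * m.derivative.eval a - 4 * n.derivative.eval a := by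
    simp [derivative_mul, derivative_pow]
  have h3 : b * (b ^ 2 + m.eval a) = 0 := by
    push_cast at h1
    simp at h1
    linear_combination h1 / 4
  rcases mul_eq_zero.1 h3 with h4 | h4
  · subst h4
    refine hc a ?_ ?_
    · rw [hc1]; linear_combination h
    · rw [hc2]; linear_combination h2
  · refine hn a ?_ ?_
    · linear_combination -h / 4 + (b ^ 2 + m.eval a) / 4 * h4
    · linear_combination -h2 / 4 + m.derivative.eval a / 2 * h4

theorem irreducible_biquadratic_of_simpleRoots {m n : ℂ[X]} (hn : SimpleRoots n)
    (hc : SimpleRoots (m ^ 2 - 4 * n)) (hn0 : ∃ a, n.eval a = 0)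
    (hc0 : ∃ a, (m ^ 2 - 4 * n).eval a = 0) :
    Irreducible (biquadratic (2 * m) (m ^ 2 - 4 * n)) := by
  obtain ⟨a, ha⟩ := hn0
  obtain ⟨b, hb⟩ := hc0
  refine irreducible_biquadratic _ _ ?_ (not_isSquare_of_simple_root hb (hc b hb))
  have e : (2 * m) ^ 2 - 4 * (m ^ 2 - 4 * n) = 16 * n := by ring
  rw [e]
  refine not_isSquare_of_simple_root (a := a) (by simp [ha]) ?_
  have := hn a ha
  simp [derivative_mul, this]

/-- A polynomial of degree at most three. -/
def cubic (a b c d : ℂ) : ℂ[X] := C a * X ^ 3 + C b * X ^ 2 + C c * X + C d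

/-- The polynomial `X⁴ p(1/X)` for `p = cubic a b c d`. -/
def cubicReverse (a b c d : ℂ) : ℂ[X] := C a * X + C b * X ^ 2 + C c * X ^ 3 + C d * X ^ 4

section Cubic
variable (a b c d x : ℂ)

theorem cubic_eval : (cubic a b c d).eval x = a * x ^ 3 + b * x ^ 2 + c * x + d := by
  simp [cubic]

theorem cubic_derivative_eval : (cubic a b c d).derivative.eval x
    = 3 * a * x ^ 2 + 2 * b * x + c := by
  simp [cubic]; ring

theorem cubicReverse_eval : (cubicReverse a b c d).eval x
    = a * x + b * x ^ 2 + c * x ^ 3 + d * x ^ 4 := by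
  simp [cubicReverse]

theorem cubicReverse_derivative_eval : (cubicReverse a b c d).derivative.eval x
    = a + 2 * b * x + 3 * c * x ^ 2 + 4 * d * x ^ 3 := by
  simp [cubicReverse]; ring

variable {a b c d}

theorem SimpleRoots.reverse (ha : a ≠ 0) (h : SimpleRoots (cubic a b c d)) :
    SimpleRoots (cubicReverse a b c d) := by
  intro x hx hx'
  rw [cubicReverse_eval] at hx
  rw [cubicReverse_derivative_eval] at hx'
  by_cases h0 : x = 0
  · subst h0
    simp [ha] at hx'
  have e : x * x⁻¹ = 1 := mul_inv_cancel₀ h0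
  generalize x⁻¹ = y at e
  have hy : a * y ^ 3 + b * y ^ 2 + c * y + d = 0 := by
    have h2 : x ^ 4 * (a * y ^ 3 + b * y ^ 2 + c * y + d) = 0 := by
      have k1 : x ^ 4 * y ^ 3 = x := by
        rw [show x ^ 4 * y ^ 3 = x * (x * y) ^ 3 by ring, e]; ring
      have k2 : x ^ 4 * y ^ 2 = x ^ 2 := by
        rw [show x ^ 4 * y ^ 2 = x ^ 2 * (x * y) ^ 2 by ring, e]; ring
      have k3 : x ^ 4 * y = x ^ 3 := by
        rw [show x ^ 4 * y = x ^ 3 * (x * y) by ring, e]; ring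
      linear_combination hx + a * k1 + b * k2 + c * k3
    exact (mul_eq_zero.1 h2).resolve_left (pow_ne_zero _ h0)
  refine h y (by rw [cubic_eval]; exact hy) ?_
  rw [cubic_derivative_eval]
  have h3 : x ^ 2 * (3 * a * y ^ 2 + 2 * b * y + c) = 0 := by
    have k1 : x ^ 2 * y ^ 2 = 1 := by rw [← mul_pow, e, one_pow]
    have k2 : x ^ 2 * y = x := by rw [show x ^ 2 * y = x * (x * y) by ring, e]; ring
    have h4 : x * (x ^ 2 * (3 * a * y ^ 2 + 2 * b * y + c)) = 0 := by
      linear_combination 3 * a * x * k1 + 2 * b * x * k2 + 4 * hx - x * hx'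
    exact (mul_eq_zero.1 h4).resolve_left h0
  exact (mul_eq_zero.1 h3).resolve_left (pow_ne_zero _ h0)

theorem cubic_exists_root (ha : a ≠ 0) : ∃ x, (cubic a b c d).eval x = 0 := by
  refine IsAlgClosed.exists_root _ ?_
  have : (cubic a b c d).degree = 3 := by
    unfold cubic; exact degree_cubic ha
  rw [this]; decide

end Cubic

/-! ### The normalized quartic model -/

section Quartic
variable (η : ℂ)

/-- Rescaled `𝔩`. -/
def quarticL : ℂ[X] := C 14 * X - C (22 * η + 4)

/-- Rescaled `𝔱`. -/
def quarticT : ℂ[X] := cubic 20 5 (-90 * η) (-(135 * η ^ 2 + 20 * η))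

/-- `X² 𝔩(1/X)`. -/
def quarticLInf : ℂ[X] := C 14 * X - C (22 * η + 4) * X ^ 2

/-- `X⁴ 𝔱(1/X)`. -/
def quarticTInf : ℂ[X] := cubicReverse 20 5 (-90 * η) (-(135 * η ^ 2 + 20 * η))

theorem quartic_disc : quarticL η ^ 2 - 4 * quarticT η
    = cubic (-80) 176 (-256 * η - 112) (1024 * η ^ 2 + 256 * η + 16) := by
  unfold quarticL quarticT cubic
  simp only [C_add, C_sub, C_mul, C_neg, C_pow, C_ofNat]
  ring

theorem quartic_disc_inf : quarticLInf η ^ 2 - 4 * quarticTInf η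
    = cubicReverse (-80) 176 (-256 * η - 112) (1024 * η ^ 2 + 256 * η + 16) := by
  unfold quarticLInf quarticTInf cubicReverse
  simp only [C_add, C_sub, C_mul, C_neg, C_pow, C_ofNat]
  ring

variable {η}

theorem simpleRoots_quarticT (h0 : η ≠ 0) (h1 : 27 * η ≠ 1) : SimpleRoots (quarticT η) := by
  intro x hx hx'
  unfold quarticT at hx hx'
  rw [cubic_eval] at hx
  rw [cubic_derivative_eval] at hx'
  -- The derivative is linear in η. Eliminating η leaves a polynomial in x whose roots 0 and -1/3
  -- give η = 0 and η = 1/27.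
  have hη : η = (6 * x ^ 2 + x) / 9 := by linear_combination -hx' / 90
  subst hη
  have h2 : x * (3 * x + 1) ^ 3 = 0 := by linear_combination -9 / 20 * hx
  rcases mul_eq_zero.1 h2 with h3 | h3
  · exact h0 (by rw [h3]; norm_num)
  · have h3 := pow_eq_zero_iff (n := 3) (by norm_num) |>.1 h3
    exact h1 (by linear_combination (6 * x - 1) * h3)

theorem simpleRoots_quartic_disc (h0 : η ≠ 0) (h1 : 27 * η ≠ 1) (h2 : 5 * η ≠ -1) :
    SimpleRoots (quarticL η ^ 2 - 4 * quarticT η) := by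
  intro x hx hx'
  rw [quartic_disc] at hx hx'
  rw [cubic_eval] at hx
  rw [cubic_derivative_eval] at hx'
  -- The same elimination: the double roots x = 1, 5/9, 1/5 occur for η = 0, 1/27, -1/5, the
  -- equilibrium levels divided by φ³.
  have hη : η = -(15 * x - 7) * (x - 1) / 16 := by linear_combination -hx' / 256
  subst hη
  have h3 : (x - 1) ^ 2 * ((9 * x - 5) * (5 * x - 1)) = 0 := by
    linear_combination hx / 20
  rcases mul_eq_zero.1 h3 with h3 | h3
  · have h3 := pow_eq_zero_iff (n := 2) (by norm_num) |>.1 h3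
    exact h0 (by rw [h3]; ring)
  rcases mul_eq_zero.1 h3 with h3 | h3
  · exact h1 (by linear_combination (-45 * x / 16 + 41 / 16) * h3)
  · exact h2 (by linear_combination (-15 * x / 16 + 19 / 16) * h3)

end Quartic

end

/-! ### Cohomology of the quartic -/

section

open Polynomial

section Genus
variable {K : Type*} [Field K] [Algebra ℂ K]

/-- Integral closure of a polynomial ring in one coordinate of a biquadratic curve. -/
theorem biquadratic_integralOver {m n : ℂ[X]} (hn : SimpleRoots n)
    (hc : SimpleRoots (m ^ 2 - 4 * n)) (hn0 : ∃ a, n.eval a = 0)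
    (hc0 : ∃ a, (m ^ 2 - 4 * n).eval a = 0) {x w : K} (hx : Transcendental ℂ x)
    (h : (w ^ 2 + aeval x m) ^ 2 = 4 * aeval x n) (hK : IntermediateField.adjoin ℂ {x, w} = ⊤) :
    LinearIndependent ℂ (fun ij : ℕ × Fin 4 => x ^ ij.1 * w ^ (ij.2 : ℕ)) ∧
    Subalgebra.toSubmodule (integralOver {x}) =
      Submodule.span ℂ (Set.range fun ij : ℕ × Fin 4 => x ^ ij.1 * w ^ (ij.2 : ℕ)) := by
  refine integralOver_eq_span (biquadratic_natDegree _ _) (biquadratic_monic _ _)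
    (irreducible_biquadratic_of_simpleRoots hn hc hn0 hc0) (smoothAffine_biquadratic hn hc) hx
    ?_ fun z => ?_
  · rw [biquadratic, eval₂_add, eval₂_add, eval₂_mul, eval₂_X_pow, eval₂_X_pow, eval₂_C, eval₂_C]
    simp only [AlgHom.toRingHom_eq_coe, RingHom.coe_coe, map_mul, map_sub, map_pow, map_ofNat]
    linear_combination h
  · have : z ∈ IntermediateField.adjoin ℂ {x, w} := by rw [hK]; trivial
    exact IntermediateField.mem_adjoin_iff_div.1 this

theorem card_inter_cone : Nat.card ↥({ij : ℤ × Fin 4 | 0 ≤ ij.1} ∩ {ij | ij.1 ≤ -(ij.2 : ℤ)}) = 1 := by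
  have : ({ij : ℤ × Fin 4 | 0 ≤ ij.1} ∩ {ij | ij.1 ≤ -(ij.2 : ℤ)}) = {(0, 0)} := by
    ext ⟨n, i⟩
    simp only [Set.mem_inter_iff, Set.mem_ofPred_eq, Set.mem_singleton_iff, Prod.mk.injEq,
      Fin.ext_iff, Fin.val_zero]
    omega
  rw [this]; simp

/-- The gaps between the two charts are the monomials w²/x, w³/x and w³/x², which form a basis of
H¹. -/
theorem card_compl_cone :
    Nat.card ↥({ij : ℤ × Fin 4 | 0 ≤ ij.1} ∪ {ij | ij.1 ≤ -(ij.2 : ℤ)})ᶜ = 3 := by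
  have : ({ij : ℤ × Fin 4 | 0 ≤ ij.1} ∪ {ij | ij.1 ≤ -(ij.2 : ℤ)})ᶜ
      = ((({(-1, 2), (-1, 3), (-2, 3)} : Finset (ℤ × Fin 4))) : Set (ℤ × Fin 4)) := by
    ext ⟨n, i⟩
    have := i.2
    simp only [Set.mem_compl_iff, Set.mem_union, Set.mem_ofPred_eq, Finset.coe_insert,
      Finset.coe_singleton, Set.mem_insert_iff, Set.mem_singleton_iff, Prod.mk.injEq,
      Fin.ext_iff, Fin.val_two, show ((3 : Fin 4) : ℕ) = 3 from rfl]
    omega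
  rw [this, Nat.card_eq_card_toFinset]; simp

theorem integralOver_congr {s u : Set K} (h : Algebra.adjoin ℂ s = Algebra.adjoin ℂ u) :
    integralOver s = integralOver u :=
  congrArg (fun S : Subalgebra ℂ K => (integralClosure S K).restrictScalars ℂ) h

theorem integralOver_smul {c : ℂ} (hc : c ≠ 0) (x : K) :
    integralOver {c • x} = integralOver {x} := by
  refine integralOver_congr (le_antisymm ?_ ?_) <;> rw [Algebra.adjoin_le_iff] <;>
    rintro z hz <;> rw [Set.mem_singleton_iff.1 hz]
  · exact Subalgebra.smul_mem _ (Algebra.self_mem_adjoin_singleton ℂ x) c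
  · have := Subalgebra.smul_mem _ (Algebra.self_mem_adjoin_singleton ℂ (c • x)) c⁻¹
    rwa [inv_smul_smul₀ hc] at this

theorem integralOver_smul_pair {c e : ℂ} (hc : c ≠ 0) (he : e ≠ 0) (x y : K) :
    integralOver {c • x, e • y} = integralOver {x, y} := by
  refine integralOver_congr (le_antisymm ?_ ?_) <;> rw [Algebra.adjoin_le_iff]
  · rintro _ (rfl | rfl)
    · exact Subalgebra.smul_mem _ (Algebra.subset_adjoin (by simp)) c
    · exact Subalgebra.smul_mem _ (Algebra.subset_adjoin (by simp)) e
  · rintro z (rfl | rfl)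
    · have : c • z ∈ Algebra.adjoin ℂ {c • z, e • y} := Algebra.subset_adjoin (by simp)
      have := Subalgebra.smul_mem _ this c⁻¹
      rwa [inv_smul_smul₀ hc] at this
    · have : e • z ∈ Algebra.adjoin ℂ {c • x, e • z} := Algebra.subset_adjoin (by simp)
      have := Subalgebra.smul_mem _ this e⁻¹
      rwa [inv_smul_smul₀ he] at this

/-- Dividing the equation by x⁴ gives a biquadratic of the same shape in (1/x, w/x), so the affine
result applies at both ends. The scalar c, which does not affect the rings, allows for the rescaled
coordinate of the original curve. -/
theorem quartic_cohomology {η c : ℂ} (h0 : η ≠ 0) (h1 : 27 * η ≠ 1) (h2 : 5 * η ≠ -1) (hc : c ≠ 0)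
    {x w : K} (hx : Transcendental ℂ x)
    (h : (w ^ 2 + aeval x (quarticL η)) ^ 2 = 4 * aeval x (quarticT η))
    (hK : IntermediateField.adjoin ℂ {x, w} = ⊤) :
    Module.finrank ℂ (LinearMap.ker (cechDiff (c • x))) = 1 ∧
    Module.finrank ℂ (integralOver {c • x, Ring.inverse (c • x)} ⧸ LinearMap.range (cechDiff (c • x)))
      = 3 := by
  have hT := simpleRoots_quarticT h0 h1
  have hD := simpleRoots_quartic_disc h0 h1 h2
  have hx0 : x ≠ 0 := by
    rintro rfl
    exact hx isAlgebraic_zero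
  obtain ⟨hli, hspan⟩ := biquadratic_integralOver hT hD
    (cubic_exists_root (by norm_num))
    (by rw [quartic_disc]; exact cubic_exists_root (by norm_num)) hx h hK
  have hxi : Transcendental ℂ x⁻¹ := fun ha => hx (IsAlgebraic.inv_iff.1 ha)
  have hi : (((w * x⁻¹) ^ 2 + aeval x⁻¹ (quarticLInf η)) ^ 2) = 4 * aeval x⁻¹ (quarticTInf η) := by
    have e : x * x⁻¹ = 1 := mul_inv_cancel₀ hx0
    simp only [quarticL, quarticT, quarticLInf, quarticTInf, cubic, cubicReverse, map_add, map_sub,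
      map_mul, map_pow, aeval_C, aeval_X] at h ⊢
    generalize x⁻¹ = y at e ⊢
    have k1 : x * y ^ 2 = y := by linear_combination y * e
    have k2 : x ^ 3 * y ^ 4 = y := by
      linear_combination (y * (x * y) ^ 2 + y * (x * y) + y) * e
    have k3 : x ^ 2 * y ^ 4 = y ^ 2 := by linear_combination (y ^ 2 * (x * y) + y ^ 2) * e
    have k4 : x * y ^ 4 = y ^ 3 := by linear_combination y ^ 3 * e
    simp only [map_ofNat, map_neg, map_mul, map_add, map_pow] at h ⊢
    linear_combination y ^ 4 * h - 14 * ((w * y) ^ 2 + (14 * y - (22 * algebraMap ℂ K η + 4) * y ^ 2)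
      + y ^ 2 * (w ^ 2 + (14 * x - (22 * algebraMap ℂ K η + 4)))) * k1 + 80 * k2 + 20 * k3 + 4 * (-90 * algebraMap ℂ K η) * k4
  have hKi : IntermediateField.adjoin ℂ {x⁻¹, w * x⁻¹} = ⊤ := by
    rw [← top_le_iff, ← hK, IntermediateField.adjoin_le_iff]
    have k1 : x⁻¹ ∈ IntermediateField.adjoin ℂ {x⁻¹, w * x⁻¹} :=
      IntermediateField.subset_adjoin _ _ (by simp)
    have k2 : w * x⁻¹ ∈ IntermediateField.adjoin ℂ {x⁻¹, w * x⁻¹} :=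
      IntermediateField.subset_adjoin _ _ (by simp)
    have k3 : x ∈ IntermediateField.adjoin ℂ {x⁻¹, w * x⁻¹} := by
      have := inv_mem k1
      rwa [inv_inv] at this
    rintro z (rfl | rfl)
    · exact k3
    · have := mul_mem k2 k3
      rwa [inv_mul_cancel_right₀ hx0] at this
  have hroot : ∃ a : ℂ, eval a (quarticLInf η ^ 2 - 4 * quarticTInf η) = 0 := by
    refine ⟨0, ?_⟩
    rw [quartic_disc_inf]
    simp [cubicReverse_eval]
  obtain ⟨-, hspani⟩ := biquadratic_integralOver (hT.reverse (by norm_num))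
    (show SimpleRoots (quarticLInf η ^ 2 - 4 * quarticTInf η) by
      rw [quartic_disc_inf]
      rw [quartic_disc] at hD
      exact hD.reverse (by norm_num))
    ⟨0, by simp [cubicReverse_eval]⟩
    hroot hxi hi hKi
  have hind := linearIndependent_laurentFamily hx0 hli
  rw [span_laurentFamily_nonneg] at hspan
  rw [span_laurentFamily_infinity hx0] at hspani
  have hw : w ∈ integralOver {x} := by
    have : w ∈ Subalgebra.toSubmodule (integralOver {x}) := by
      rw [hspan]
      exact Submodule.subset_span ⟨(0, 1), by simp, by simp [laurentFamily]⟩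
    exact this
  have hpair := integralOver_pair_eq_span hx0 hw hspan
  have hinv : Ring.inverse (c • x) = c⁻¹ • x⁻¹ := by
    rw [Ring.inverse_eq_inv', smul_inv₀]
  have e0 := integralOver_smul hc x
  have e1 : integralOver {Ring.inverse (c • x)} = integralOver {x⁻¹} := by
    rw [hinv, integralOver_smul (inv_ne_zero hc)]
  have e2 : integralOver {c • x, Ring.inverse (c • x)} = integralOver {x, x⁻¹} := by
    rw [hinv, integralOver_smul_pair hc (inv_ne_zero hc)]
  rw [← e0] at hspan
  rw [← e1] at hspani
  rw [← e2] at hpair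
  exact ⟨(finrank_ker_cechDiff hind hspan hspani).trans card_inter_cone,
    (finrank_coker_cechDiff hind hspan hspani hpair).trans card_compl_cone⟩

end Genus

end

/-! ### Reduction of the original curve to the quartic -/

section

open Polynomial

section Reduction
variable {K : Type*} [Field K] [Algebra ℂ K]

theorem intermediateField_adjoin_eq_top_of_range {f : ℂ[X][X]} (j : AdjoinRoot f →ₐ[ℂ] K)
    (hj : ∀ z : K, ∃ a b, z = j a / j b) (L : IntermediateField ℂ K)
    (hX : j (AdjoinRoot.of f X) ∈ L) (hY : j (AdjoinRoot.root f) ∈ L) : L = ⊤ := by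
  have hC : ∀ p : ℂ[X], j (AdjoinRoot.of f p) ∈ L := by
    intro p
    induction p using Polynomial.induction_on' with
    | add p q hp hq => rw [map_add, map_add]; exact add_mem hp hq
    | monomial n a =>
      rw [← C_mul_X_pow_eq_monomial, map_mul, map_pow, map_mul, map_pow]
      refine mul_mem ?_ (pow_mem hX n)
      have : AdjoinRoot.of f (C a) = algebraMap ℂ (AdjoinRoot f) a := rfl
      rw [this, j.commutes]
      exact L.algebraMap_mem a
  have hall : ∀ a, j a ∈ L := by
    intro a
    obtain ⟨g, rfl⟩ := AdjoinRoot.mk_surjective a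
    induction g using Polynomial.induction_on' with
    | add p q hp hq => rw [map_add, map_add]; exact add_mem hp hq
    | monomial n a =>
      rw [← C_mul_X_pow_eq_monomial, map_mul, map_pow, map_mul, map_pow, AdjoinRoot.mk_X]
      exact mul_mem (hC a) (pow_mem hY n)
  rw [eq_top_iff]
  intro z _
  obtain ⟨a, b, rfl⟩ := hj z
  exact div_mem (hall a) (hall b)

theorem two_ne_zero_of_complex : (2 : K) ≠ 0 := by
  have := (algebraMap ℂ K).injective.ne (two_ne_zero (α := ℂ))
  rwa [map_ofNat, map_zero] at this

/-- Passage from the plane curve of degree nine to the quartic model. -/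
theorem exists_quartic_coordinate {η : ℂ} {x y : K} (hx : Transcendental ℂ x)
    (h : (y ^ 2 + aeval x (quarticL η) * aeval x (quarticT η)) ^ 2 = 4 * aeval x (quarticT η) ^ 3) :
    ∃ w, (w ^ 2 + aeval x (quarticL η)) ^ 2 = 4 * aeval x (quarticT η) ∧
      2 * y = w * (w ^ 2 + aeval x (quarticL η)) := by
  have hT : quarticT η ≠ 0 := by
    intro h0
    have := congrArg (fun p : ℂ[X] => p.coeff 3) h0
    simp [quarticT, cubic, -map_mul, -map_add, -map_pow] at this
  have hT0 : aeval x (quarticT η) ≠ 0 := fun h0 => hT ((transcendental_iff.1 hx) _ h0)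
  generalize aeval x (quarticT η) = T at *
  generalize aeval x (quarticL η) = L at *
  have h2 : (2 : K) ≠ 0 := two_ne_zero_of_complex
  -- The relation says that this s is a square root of T in K; the quartic coordinate is w = y/s,
  -- with w² + L = 2s.
  obtain ⟨s, hs⟩ : ∃ s, y ^ 2 + L * T = 2 * T * s :=
    ⟨(y ^ 2 + L * T) / (2 * T), by field_simp⟩
  have hs2 : s ^ 2 = T := by
    rw [hs] at h
    have : 4 * T ^ 2 * (s ^ 2 - T) = 0 := by linear_combination h
    have h4 : (4 : K) * T ^ 2 ≠ 0 := by
      rw [show (4 : K) * T ^ 2 = (2 * T) ^ 2 by ring]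
      exact pow_ne_zero _ (mul_ne_zero h2 hT0)
    exact sub_eq_zero.1 ((mul_eq_zero.1 this).resolve_left h4)
  have hs0 : s ≠ 0 := by rintro rfl; exact hT0 (by rw [← hs2]; ring)
  subst hs2
  have hw : (y / s) ^ 2 + L = 2 * s := by
    have : s ^ 2 * ((y / s) ^ 2 + L - 2 * s) = 0 := by
      field_simp
      linear_combination hs
    exact sub_eq_zero.1 ((mul_eq_zero.1 this).resolve_left (pow_ne_zero _ hs0))
  refine ⟨y / s, by rw [hw]; ring, ?_⟩
  rw [hw]
  field_simp

theorem aeval_lPoly_map (ξ : ℝ) (x : K) : aeval x ((lPoly ξ).map (algebraMap ℝ ℂ))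
    = 14 * algebraMap ℂ K phi * x - 22 * algebraMap ℂ K ξ - 4 * algebraMap ℂ K phi ^ 3 := by
  unfold lPoly
  generalize phi = φ
  simp [map_ofNat]

theorem aeval_tPoly_map (ξ : ℝ) (x : K) : aeval x ((tPoly ξ).map (algebraMap ℝ ℂ))
    = 20 * x ^ 3 + 5 * algebraMap ℂ K phi ^ 2 * x ^ 2
      - 90 * algebraMap ℂ K phi * algebraMap ℂ K ξ * x - 135 * algebraMap ℂ K ξ ^ 2
      - 20 * algebraMap ℂ K phi ^ 3 * algebraMap ℂ K ξ := by
  unfold tPoly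
  generalize phi = φ
  simp [map_ofNat]

theorem aeval_quarticL (η : ℂ) (x : K) : aeval x (quarticL η)
    = 14 * x - (22 * algebraMap ℂ K η + 4) := by
  simp [quarticL, map_ofNat]

theorem aeval_quarticT (η : ℂ) (x : K) : aeval x (quarticT η)
    = 20 * x ^ 3 + 5 * x ^ 2 - 90 * algebraMap ℂ K η * x - (135 * algebraMap ℂ K η ^ 2
      + 20 * algebraMap ℂ K η) := by
  simp [quarticT, cubic, map_ofNat]; ring

theorem eval₂_curvePoly (ξ : ℝ) (x y : K) :
    (curvePoly ξ).eval₂ (aeval x : ℂ[X] →ₐ[ℂ] K).toRingHom y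
      = (y ^ 2 * algebraMap ℂ K phi ^ 5 + aeval x ((lPoly ξ).map (algebraMap ℝ ℂ))
        * aeval x ((tPoly ξ).map (algebraMap ℝ ℂ))) ^ 2
        - 4 * aeval x ((tPoly ξ).map (algebraMap ℝ ℂ)) ^ 3 := by
  rw [curvePoly, Polynomial.map_mul]
  simp only [eval₂_sub, eval₂_mul, eval₂_add, eval₂_pow, eval₂_X, eval₂_C, eval₂_ofNat,
    AlgHom.toRingHom_eq_coe, RingHom.coe_coe, aeval_C, map_pow, map_mul]

theorem phi_pow_three_ratio {ξ : ℝ} (h0 : ξ ≠ 0) (h1 : 27 * ξ ≠ phi ^ 3) (h2 : 5 * ξ ≠ -phi ^ 3) :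
    ∃ η : ℂ, (ξ : ℂ) = (phi : ℂ) ^ 3 * η ∧ η ≠ 0 ∧ 27 * η ≠ 1 ∧ 5 * η ≠ -1 := by
  have hφ := phi_ne_zero
  refine ⟨ξ / (phi : ℂ) ^ 3, (mul_div_cancel₀ _ (pow_ne_zero 3 hφ)).symm, ?_, ?_, ?_⟩
  · exact div_ne_zero (by exact_mod_cast h0) (pow_ne_zero 3 hφ)
  · intro h
    rw [← mul_div_assoc, div_eq_one_iff_eq (pow_ne_zero 3 hφ)] at h
    exact h1 (by exact_mod_cast h)
  · intro h
    rw [← mul_div_assoc, div_eq_iff (pow_ne_zero 3 hφ), neg_one_mul] at h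
    exact h2 (by exact_mod_cast h)

theorem curve_cohomology {ξ : ℝ} (h0 : ξ ≠ 0) (h1 : 27 * ξ ≠ phi ^ 3) (h2 : 5 * ξ ≠ -phi ^ 3)
    {x' y' : K} (hx' : Transcendental ℂ x')
    (hrel : (curvePoly ξ).eval₂ (aeval x' : ℂ[X] →ₐ[ℂ] K).toRingHom y' = 0)
    (htop : ∀ L : IntermediateField ℂ K, x' ∈ L → y' ∈ L → L = ⊤) :
    Module.finrank ℂ (LinearMap.ker (cechDiff x')) = 1 ∧
    Module.finrank ℂ (integralOver {x', Ring.inverse x'} ⧸ LinearMap.range (cechDiff x')) = 3 := by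
  have hφ := phi_ne_zero
  have hφK : algebraMap ℂ K phi ≠ 0 := (_root_.map_ne_zero _).2 hφ
  obtain ⟨η, hη, hη0, hη1, hη2⟩ := phi_pow_three_ratio h0 h1 h2
  rw [eval₂_curvePoly, aeval_lPoly_map, aeval_tPoly_map, hη, map_mul, map_pow] at hrel
  generalize (phi : ℂ) = c at *
  -- For ξ = φ³η, scaling both coordinates by φ² turns 𝔩 into φ³ times its φ-free form, 𝔱 into φ⁶
  -- times its own, and Y²φ⁵ into φ⁹y². The relation therefore acquires the common factor φ¹⁸.
  obtain ⟨x, rfl⟩ : ∃ x, x' = (c ^ 2) • x :=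
    ⟨(c ^ 2)⁻¹ • x', by rw [smul_inv_smul₀ (pow_ne_zero _ hφ)]⟩
  obtain ⟨y, rfl⟩ : ∃ y, y' = (c ^ 2) • y :=
    ⟨(c ^ 2)⁻¹ • y', by rw [smul_inv_smul₀ (pow_ne_zero _ hφ)]⟩
  have hx : Transcendental ℂ x := by
    intro ha
    apply hx'
    rw [Algebra.smul_def]
    exact (isAlgebraic_algebraMap _).mul ha
  have hxy : (y ^ 2 + aeval x (quarticL η) * aeval x (quarticT η)) ^ 2
      = 4 * aeval x (quarticT η) ^ 3 := by
    rw [aeval_quarticL, aeval_quarticT]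
    rw [Algebra.smul_def, Algebra.smul_def, map_pow] at hrel
    generalize algebraMap ℂ K c = φ at *
    refine mul_left_cancel₀ (pow_ne_zero 18 hφK) ?_
    linear_combination hrel
  obtain ⟨w, hw, hyw⟩ := exists_quartic_coordinate hx hxy
  have hxL : x ∈ IntermediateField.adjoin ℂ {x, w} :=
    IntermediateField.subset_adjoin _ _ (by simp)
  have hwL : w ∈ IntermediateField.adjoin ℂ {x, w} :=
    IntermediateField.subset_adjoin _ _ (by simp)
  refine quartic_cohomology hη0 hη1 hη2 (pow_ne_zero 2 hφ) hx hw (htop _ ?_ ?_)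
  · exact IntermediateField.smul_mem _ hxL
  · refine IntermediateField.smul_mem _ ?_
    -- This puts y in ℂ(x, w), so x and w generate the whole function field.
    have : y = w * (w ^ 2 + aeval x (quarticL η)) / 2 := by
      rw [← hyw, mul_div_cancel_left₀ _ two_ne_zero_of_complex]
    rw [this, aeval_quarticL]
    have h14 : ∀ c : ℂ, algebraMap ℂ K c ∈ IntermediateField.adjoin ℂ {x, w} := fun c =>
      (IntermediateField.adjoin ℂ {x, w}).algebraMap_mem c
    refine div_mem (mul_mem hwL (add_mem (pow_mem hwL 2) (sub_mem (mul_mem ?_ hxL)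
      (add_mem (mul_mem ?_ (h14 _)) ?_)))) ?_ <;> exact ofNat_mem _ _

theorem algHom_adjoinRoot_mk {f : ℂ[X][X]} (j : AdjoinRoot f →ₐ[ℂ] K) (g : ℂ[X][X]) :
    j (AdjoinRoot.mk f g) = g.eval₂ (aeval (j (AdjoinRoot.of f X)) : ℂ[X] →ₐ[ℂ] K).toRingHom
      (j (AdjoinRoot.root f)) := by
  have hC : ∀ p : ℂ[X], j (AdjoinRoot.of f p) = aeval (j (AdjoinRoot.of f X)) p := by
    intro p
    have h : j.comp (AdjoinRoot.ofAlgHom ℂ f) = aeval (j (AdjoinRoot.of f X)) := by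
      apply Polynomial.algHom_ext
      rw [aeval_X]
      rfl
    exact DFunLike.congr_fun h p
  induction g using Polynomial.induction_on' with
  | add p q hp hq => rw [map_add, map_add, hp, hq, eval₂_add]
  | monomial n a =>
    rw [← C_mul_X_pow_eq_monomial, map_mul, map_pow, map_mul, map_pow, AdjoinRoot.mk_X,
      eval₂_mul, eval₂_X_pow, eval₂_C]
    exact congrArg (· * _) (hC a)

end Reduction

theorem arithmeticGenus_curvePoly {ξ : ℝ} (h0 : ξ ≠ 0) (h1 : 27 * ξ ≠ phi ^ 3)
    (h2 : 5 * ξ ≠ -phi ^ 3) : arithmeticGenus (curvePoly ξ) = 3 := by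
  have hdom : IsDomain (AdjoinRoot (curvePoly ξ)) :=
    AdjoinRoot.isDomain_of_prime (irreducible_curvePoly ξ).prime
  have hinj : Function.Injective (algebraMap (AdjoinRoot (curvePoly ξ))
      (FunctionField (curvePoly ξ))) := IsFractionRing.injective _ _
  let j := IsScalarTower.toAlgHom ℂ (AdjoinRoot (curvePoly ξ)) (FunctionField (curvePoly ξ))
  have hdeg : (curvePoly ξ).degree ≠ 0 := by
    rw [curvePoly_eq, degree_C_mul (C_ne_zero.2 (pow_ne_zero _ phi_ne_zero)),
      degree_eq_natDegree (biquadratic_monic _ _).ne_zero, biquadratic_natDegree]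
    decide
  have hx : Transcendental ℂ (j (AdjoinRoot.of (curvePoly ξ) X)) := by
    rw [transcendental_iff]
    intro p hp
    have hp' : j (AdjoinRoot.mk (curvePoly ξ) (C p)) = 0 := by
      rw [algHom_adjoinRoot_mk, eval₂_C]
      exact hp
    have hp2 : AdjoinRoot.of (curvePoly ξ) p = 0 := hinj (hp'.trans (map_zero _).symm)
    exact AdjoinRoot.of.injective_of_degree_ne_zero hdeg (hp2.trans (map_zero _).symm)
  have hrel := algHom_adjoinRoot_mk j (curvePoly ξ)
  rw [AdjoinRoot.mk_self, map_zero] at hrel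
  have h := curve_cohomology h0 h1 h2 hx hrel.symm fun L hX hY =>
    intermediateField_adjoin_eq_top_of_range j (fun z => by
      obtain ⟨a, b, -, h⟩ := IsFractionRing.div_surjective (A := AdjoinRoot (curvePoly ξ)) z
      exact ⟨a, b, h.symm⟩) L hX hY
  have e0 : hZero (curvePoly ξ) = 1 := h.1
  have e1 : hOne (curvePoly ξ) = 3 := h.2
  rw [arithmeticGenus, e0, e1]
  norm_num

end

end Icosahedral

end

theorem mainTheorem5 (ξ : ℝ) (hξ₁ : -((2 + √5) / 5) < ξ) (hξ₂ : ξ < (2 + √5) / 27) :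
    (∀ (J : Set ℝ) (p q r : ℝ → ℝ), IsOpen J → J.OrdConnected → J.Nonempty →
      Icosahedral.IsSolution ξ J p q r →
      ∀ X : ℝ → ℝ,
        X = Icosahedral.quad p q ∨ X = Icosahedral.quad q r ∨ X = Icosahedral.quad r p →
        (ξ = 0 → ∀ t ∈ J, X t ≠ 0) →
        (∀ t ∈ J, X t ≠ 0 ∧ DifferentiableAt ℝ (Icosahedral.upsilon ξ X) t ∧
          (deriv (Icosahedral.upsilon ξ X) t ^ 2 * Icosahedral.phi ^ 5
              + (Icosahedral.lPoly ξ).eval (Icosahedral.upsilon ξ X t)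
                * (Icosahedral.tPoly ξ).eval (Icosahedral.upsilon ξ X t)) ^ 2
            = 4 * (Icosahedral.tPoly ξ).eval (Icosahedral.upsilon ξ X t) ^ 3) ∧
        ((ξ = 0 → ¬ ∀ t ∈ J, ∀ s ∈ J, p t = p s ∧ q t = q s ∧ r t = r s) →
          Icosahedral.Parametrizes (Icosahedral.curvePoly ξ) J (Icosahedral.upsilon ξ X)
            (deriv (Icosahedral.upsilon ξ X)))) ∧
    (ξ ≠ 0 → Irreducible (Icosahedral.curvePoly ξ) ∧
      Icosahedral.arithmeticGenus (Icosahedral.curvePoly ξ) = 3) := by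
  have hφ : Icosahedral.phi ^ 3 = 2 + √5 := by
    rw [Icosahedral.phi_pow.2.1, Icosahedral.sqrt_five_eq]; ring
  refine ⟨fun J p q r hJ hJc hne h X hX h0 =>
    Icosahedral.upsilon_curve hξ₁ hξ₂ hJ hJc hne h hX h0, fun h0 =>
    ⟨Icosahedral.irreducible_curvePoly ξ, Icosahedral.arithmeticGenus_curvePoly h0 ?_ ?_⟩⟩
  · rw [hφ]
    exact ne_of_lt (by linarith)
  · rw [hφ]
    exact ne_of_gt (by linarith)
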